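/- Let $\alpha=(\alpha_1,\dots,\alpha_n)\in\mathbb{Z}_{\ge 0}^n$ be a composition. Its skyline diagram $D(\alpha)$ is the left-justified array with $\alpha_i$ boxes in row $i$, rows numbered from top to bottom, columns from left to right. A semistandard skyline filling $F\in\mathrm{SSF}(\alpha)$ assigns a positive integer $F(i,j)$ to each box $(i,j)$ of $D(\alpha)$ such that: (i) entries weakly decrease from left to right in each row; (ii) $F(i,j)\le i$; (iii) entries in each column are distinct; (iv) if an entry $a$ is below an entry $b$ in the same column and $a<b$, then there is an entry $c$ immediately to the right of $b$, and $a<c$. Put $x^F=\prod_{(i,j)\in D(\alpha)}x_{F(i,j)}$. On $\mathbb{Z}[x_1,\dots,x_n]$ let $\partial_r f=(f-s_rf)/(x_r-x_{r+1})$, where $s_r$ interchanges $x_r$ and $x_{r+1}$, and let $\pi_r f=\partial_r(x_rf)$. The key polynomial $\kappa_\alpha$ is $x_1^{\alpha_1}\cdots x_n^{\alpha_n}$ if $\alpha_1\ge\cdots\ge\alpha_n$; otherwise $\kappa_\alpha=\pi_i(\kappa_{\alpha'})$ for any $i$ with $\alpha_i<\alpha_{i+1}$, where $\alpha'$ is $\alpha$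 with $\alpha_i$ and $\alpha_{i+1}$ interchanged. Then the following hold. (1) If $r$ is the first ascent of $\alpha$ (i.e. $\alpha_1\ge\cdots\ge\alpha_r$ and $\alpha_r<\alpha_{r+1}$) and $\alpha'$ is $\alpha$ with $\alpha_r$ and $\alpha_{r+1}$ interchanged, then $$\pi_r\Big(\sum_{F'\in\mathrm{SSF}(\alpha')}x^{F'}\Big)=\sum_{F\in\mathrm{SSF}(\alpha)}x^F .$$ (2) $\kappa_\alpha=\sum_{F\in\mathrm{SSF}(\alpha)}x^F$; that is, every sequence of choices of ascents in the recursive definition of $\kappa_\alpha$ yields this polynomial. (3) Let $E_\alpha(x;q,t)$ be the nonsymmetric Macdonald polynomial, given by the Haglund–Haiman–Loehr formula $$E_\alpha(x;q,t)=\sum_{F}x^F\,q^{\mathrm{maj}(F)}\,t^{\mathrm{coinv}(F)}\prod_{u\in D(\alpha),\ \hat F(u)\ne\hat F(d(u))}\frac{1-t}{1-q^{\mathrm{leg}(u)+1}t^{\mathrm{arm}(u)+1}} .$$ Then $E_\alpha(x;0,0)=\kappa_\alpha$. (At $q=t=0$ all denominators are equal to $1$.) In this formula, the augmented diagram is $D(\alpha)$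 together with the basement boxes $(i,0)$, $1\le i\le n$; for $F:D(\alpha)\to\{1,\dots,n\}$, $\hat F$ extends $F$ by $\hat F(i,0)=i$. The sum is over the non-attacking $F$, those for which the entries of $\hat F$ in each column are distinct and $\hat F(i,j)\ne\hat F(i',j+1)$ for boxes with $i>i'$. For $u=(i,j)\in D(\alpha)$, $d(u)=(i,j-1)$ and $\mathrm{leg}(u)=\alpha_i-j$; $\mathrm{Arm}(u)$ consists of the boxes $(i',j)\in D(\alpha)$ with $i'<i$, $\alpha_{i'}\le\alpha_i$ and the boxes $(i',j-1)$ of the augmented diagram with $i'>i$, $\alpha_{i'}<\alpha_i$; and $\mathrm{arm}(u)=|\mathrm{Arm}(u)|$. Further, $\mathrm{maj}(F)$ is the sum of $\mathrm{leg}(u)+1$ over the $u\in D(\alpha)$ with $\hat F(u)>\hat F(d(u))$, and $\mathrm{coinv}(F)$ is the number of pairs $(u,v)$, $u\in D(\alpha)$, $v\in\mathrm{Arm}(u)$, such that $\hat F(u)<\hat F(v)<\hat F(d(u))$ up to cyclic rotation of these three entries. -/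

import Mathlib

open MvPolynomial

noncomputable section

namespace Skyline

/-! Conventions: a composition of length `n` is a function `α : Fin n → ℕ`.  Rows, columns and
entries are numbered from `0`, so that row `i : Fin n` is the `(i+1)`-st row and the entry
`a : Fin n` stands for the positive integer `a + 1`. -/

/-! ### Divided differences, Demazure operators and key polynomials -/

/-- The action of the simple transposition on polynomials: interchange `x_r` and `x_{r+1}`. -/
def simpleSwap {n : ℕ} (r : ℕ) (hr : r + 1 < n) (f : MvPolynomial (Fin n) ℤ) :
    MvPolynomial (Fin n) ℤ :=
  rename (Equiv.swap (⟨r, by omega⟩ : Fin n) ⟨r + 1, hr⟩) f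

theorem sub_dvd_sub_simpleSwap {n : ℕ} (r : ℕ) (hr : r + 1 < n) (f : MvPolynomial (Fin n) ℤ) :
    (X (⟨r, by omega⟩ : Fin n) - X ⟨r + 1, hr⟩ : MvPolynomial (Fin n) ℤ) ∣
      f - simpleSwap r hr f := by
  unfold simpleSwap
  induction f using MvPolynomial.induction_on with
  | C a => simp
  | add p q hp hq =>
    rw [map_add, add_sub_add_comm]
    exact dvd_add hp hq
  | mul_X p i hp =>
    rw [map_mul, rename_X]
    set τ := Equiv.swap (⟨r, by omega⟩ : Fin n) ⟨r + 1, hr⟩ with hτ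
    have h : (X (⟨r, by omega⟩ : Fin n) - X ⟨r + 1, hr⟩ : MvPolynomial (Fin n) ℤ) ∣
        X i - X (τ i) := by
      by_cases h1 : i = ⟨r, by omega⟩
      · rw [h1, hτ, Equiv.swap_apply_left]
      · by_cases h2 : i = ⟨r + 1, hr⟩
        · rw [h2, hτ, Equiv.swap_apply_right]
          exact (dvd_sub_comm).mp dvd_rfl
        · rw [hτ, Equiv.swap_apply_of_ne_of_ne h1 h2, sub_self]
          exact dvd_zero _
    have e : p * X i - rename τ p * X (τ i) =
        (p - rename τ p) * X i + rename τ p * (X i - X (τ i)) := by ring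
    rw [e]
    exact dvd_add (hp.mul_right _) (h.mul_left _)

/-- The divided difference operator `∂_r f = (f - s_r f) / (x_r - x_{r+1})`, the (unique) exact
quotient in the polynomial ring. -/
def dividedDiff {n : ℕ} (r : ℕ) (hr : r + 1 < n) (f : MvPolynomial (Fin n) ℤ) :
    MvPolynomial (Fin n) ℤ :=
  Classical.choose (sub_dvd_sub_simpleSwap r hr f)

theorem dividedDiff_spec {n : ℕ} (r : ℕ) (hr : r + 1 < n) (f : MvPolynomial (Fin n) ℤ) :
    f - simpleSwap r hr f =
      (X (⟨r, by omega⟩ : Fin n) - X ⟨r + 1, hr⟩) * dividedDiff r hr f :=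
  Classical.choose_spec (sub_dvd_sub_simpleSwap r hr f)

/-- The Demazure operator `π_r f = ∂_r (x_r f)`. -/
def demazure {n : ℕ} (r : ℕ) (hr : r + 1 < n) (f : MvPolynomial (Fin n) ℤ) :
    MvPolynomial (Fin n) ℤ :=
  dividedDiff r hr (X (⟨r, by omega⟩ : Fin n) * f)

/-- The composition obtained from `α` by interchanging `α_r` and `α_{r+1}`. -/
def swapParts {n : ℕ} (r : ℕ) (hr : r + 1 < n) (α : Fin n → ℕ) : Fin n → ℕ :=
  fun i => α (Equiv.swap (⟨r, by omega⟩ : Fin n) ⟨r + 1, hr⟩ i)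

/-- `r` is the first ascent of `α`: `α_0 ≥ ⋯ ≥ α_r` and `α_r < α_{r+1}`. -/
def IsFirstAscent {n : ℕ} (α : Fin n → ℕ) (r : ℕ) (hr : r + 1 < n) : Prop :=
  (∀ i j : Fin n, i ≤ j → (j : ℕ) ≤ r → α j ≤ α i) ∧ α ⟨r, by omega⟩ < α ⟨r + 1, hr⟩

/-- `IsKeyPoly α f`: the recursive definition of the key polynomial `κ_α` yields `f` for some
sequence of choices of ascents.  For a partition `α` it yields `x^α`; otherwise one chooses any
`r` with `α_r < α_{r+1}` and applies `π_r` to a key polynomial of `α` with these parts swapped. -/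
inductive IsKeyPoly {n : ℕ} : (Fin n → ℕ) → MvPolynomial (Fin n) ℤ → Prop
  | partition (α : Fin n → ℕ) (hα : Antitone α) : IsKeyPoly α (∏ i, X i ^ α i)
  | ascent (α : Fin n → ℕ) (r : ℕ) (hr : r + 1 < n) (hlt : α ⟨r, by omega⟩ < α ⟨r + 1, hr⟩)
      (f : MvPolynomial (Fin n) ℤ) (hf : IsKeyPoly (swapParts r hr α) f) :
      IsKeyPoly α (demazure r hr f)

/-! ### Skyline fillings -/

/-- Fillings of the skyline diagram of `α` (row `i` has `α i` boxes) with entries in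
`{1, …, n}`.  The flag condition below bounds all entries by `n`. -/
abbrev Filling {n : ℕ} (α : Fin n → ℕ) : Type := (i : Fin n) → Fin (α i) → Fin n

/-- Semistandard skyline fillings. -/
structure IsSSF {n : ℕ} (α : Fin n → ℕ) (F : Filling α) : Prop where
  /-- Entries weakly decrease from left to right in each row. -/
  row : ∀ (i : Fin n) (j k : Fin (α i)), j ≤ k → F i k ≤ F i j
  /-- Each entry is at most its row index. -/
  flag : ∀ (i : Fin n) (j : Fin (α i)), F i j ≤ i
  /-- Entries are distinct in each column. -/
  column : ∀ (i i' : Fin n) (j : ℕ) (h : j < α i) (h' : j < α i'), i ≠ i' →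
    F i ⟨j, h⟩ ≠ F i' ⟨j, h'⟩
  /-- If `a` in row `i'` is below `b` in row `i`, in the same column, and `a < b`, then there is
  an entry `c` immediately to the right of `b`, and `a < c`. -/
  triple : ∀ (i i' : Fin n) (j : ℕ) (h : j < α i) (h' : j < α i'), i < i' →
    F i' ⟨j, h'⟩ < F i ⟨j, h⟩ → ∃ hc : j + 1 < α i, F i' ⟨j, h'⟩ < F i ⟨j + 1, hc⟩

/-- The monomial `x^F`, the product of `x_{F(u)}` over the boxes `u`. -/
def weight {n : ℕ} (R : Type*) [CommSemiring R] {α : Fin n → ℕ} (F : Filling α) :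
    MvPolynomial (Fin n) R :=
  ∏ i, ∏ j, X (F i j)

open scoped Classical in
/-- The generating polynomial of the semistandard skyline fillings for `α`. -/
def ssfPoly {n : ℕ} (α : Fin n → ℕ) : MvPolynomial (Fin n) ℤ :=
  ∑ F : Filling α with IsSSF α F, weight ℤ F

/-! ### The Haglund–Haiman–Loehr formula

The augmented diagram has an additional column `0`, the basement, in front of the diagram:
row `i` then has the columns `0, …, α i`, and the basement box of row `i` has the entry `i`. -/

/-- Boxes of the diagram; `⟨i, j⟩` lies in column `j + 1` of the augmented diagram. -/
abbrev Box {n : ℕ} (α : Fin n → ℕ) : Type := (i : Fin n) × Fin (α i)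

/-- Boxes of the augmented diagram. -/
abbrev AugBox {n : ℕ} (α : Fin n → ℕ) : Type := (i : Fin n) × Fin (α i + 1)

/-- A box of the diagram as a box of the augmented diagram. -/
def Box.toAug {n : ℕ} {α : Fin n → ℕ} (u : Box α) : AugBox α := ⟨u.1, u.2.succ⟩

/-- The box immediately to the left of `u` in the augmented diagram. -/
def Box.left {n : ℕ} {α : Fin n → ℕ} (u : Box α) : AugBox α := ⟨u.1, u.2.castSucc⟩

/-- The augmented filling: `F` on the diagram, and the row index on the basement. -/
def augFilling {n : ℕ} {α : Fin n → ℕ} (F : Filling α) (b : AugBox α) : Fin n :=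
  Fin.cases (motive := fun _ => Fin n) b.1 (F b.1) b.2

/-- Two boxes attack each other if they are distinct boxes of the same column, or they lie in
consecutive columns and the one in the left column is in a strictly lower row. -/
def Attacks {n : ℕ} {α : Fin n → ℕ} (u v : AugBox α) : Prop :=
  (u.1 ≠ v.1 ∧ (u.2 : ℕ) = v.2) ∨ (v.1 < u.1 ∧ (v.2 : ℕ) = u.2 + 1)

/-- The augmented filling is non-attacking. -/
def IsNonAttacking {n : ℕ} {α : Fin n → ℕ} (F : Filling α) : Prop :=
  ∀ u v : AugBox α, Attacks u v → augFilling F u ≠ augFilling F v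

/-- The number of boxes to the right of `u` in its row. -/
def leg {n : ℕ} {α : Fin n → ℕ} (u : Box α) : ℕ := α u.1 - (u.2 + 1)

/-- The arm of `u`: the boxes of the column of `u` in higher rows that are not longer than the
row of `u`, and the boxes of the preceding column of the augmented diagram in lower rows that are
strictly shorter than the row of `u`. -/
def arm {n : ℕ} {α : Fin n → ℕ} (u : Box α) : Finset (AugBox α) :=
  {v | (v.1 < u.1 ∧ α v.1 ≤ α u.1 ∧ (v.2 : ℕ) = u.2 + 1) ∨
       (u.1 < v.1 ∧ α v.1 < α u.1 ∧ (v.2 : ℕ) = u.2)}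

/-- The major index: the sum of `leg u + 1` over the boxes `u` with an entry strictly larger
than the entry immediately to the left. -/
def maj {n : ℕ} {α : Fin n → ℕ} (F : Filling α) : ℕ :=
  ∑ u : Box α with augFilling F u.left < augFilling F u.toAug, (leg u + 1)

/-- `a < b < c` up to cyclic rotation. -/
def CyclicLT {n : ℕ} (a b c : Fin n) : Prop :=
  (a < b ∧ b < c) ∨ (b < c ∧ c < a) ∨ (c < a ∧ a < b)

open scoped Classical in
/-- The coinversion number of a non-attacking filling: the number of coinversion triples, i.e.
of `u` in the diagram, `w` immediately to the left of `u`, and `v` in the arm of `u`, whose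
entries satisfy `F u < F v < F w` up to cyclic rotation. -/
def coinv {n : ℕ} {α : Fin n → ℕ} (F : Filling α) : ℕ :=
  ∑ u : Box α, (Finset.card {v ∈ arm u |
    CyclicLT (augFilling F u.toAug) (augFilling F v) (augFilling F u.left)})

open scoped Classical in
/-- The nonsymmetric Macdonald polynomial `E_α(x; q, t)` with parameters `q, t` in a field, as
given by the Haglund–Haiman–Loehr formula. -/
def macdonaldE {n : ℕ} {K : Type*} [Field K] (α : Fin n → ℕ) (q t : K) :
    MvPolynomial (Fin n) K :=
  ∑ F : Filling α with IsNonAttacking F,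
    C (q ^ maj F * t ^ coinv F *
      ∏ u : Box α with augFilling F u.toAug ≠ augFilling F u.left,
        (1 - t) / (1 - q ^ (leg u + 1) * t ^ ((arm u).card + 1))) * weight K F

end Skyline

end

namespace Skyline

/-! ### The Demazure operator -/

section Operator

variable {n : ℕ} {r : ℕ} {hr : r + 1 < n}

/-! Fillings are built column by column. For a column σ, let P(β, σ) (`columnPoly`) be the sum over
all ways to continue to the right of σ with remaining row lengths β. The basement 1, …, n acts as a
virtual column: that the first column follows it is exactly the flag condition, so the skyline
polynomial of α is P(α, basement).

Put a = r + 1 and let s interchange the values a and a + 1. By `demazure_columnPoly`, π_r P(β, σ) is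
P(β, σ) if σ contains neither value, P(β, sσ) if it contains only a, and P(β, σ) + P(β, sσ) if it
contains both with a above a + 1. This goes by induction on the number of columns. The possible next
columns are grouped into orbits of s; π_r sends the term of the "head" of a two-element orbit to the
sum over the orbit and kills the other term, so it remains to compare which columns may follow σ and
sσ.

By `columnPoly_eq_add`, if row p lies directly above a longer row q and σ has nonempty entries there
with σ p < σ q, then P(β, σ) = P(β', σ) + P(β', σ'), where primes interchange the two rows. On the
basement, interchanging two adjacent values is the same as interchanging two adjacent rows. So the
two identities combine to π_r P(α', basement) = P(α, basement), at every ascent. A partition has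
exactly one filling, and induction along the recursion gives the key polynomials.

At q = t = 0 the Haglund–Haiman–Loehr sum keeps only the non-attacking fillings with maj = coinv =
0, which `isSSF_iff` identifies with the semistandard skyline fillings. -/

theorem simpleSwap_mul (f g : MvPolynomial (Fin n) ℤ) :
    simpleSwap r hr (f * g) = simpleSwap r hr f * simpleSwap r hr g := by
  simp [simpleSwap]

theorem simpleSwap_simpleSwap (f : MvPolynomial (Fin n) ℤ) :
    simpleSwap r hr (simpleSwap r hr f) = f := by
  rw [simpleSwap, simpleSwap, rename_rename]
  simp [← Equiv.coe_trans]

theorem simpleSwap_X_left :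
    simpleSwap r hr (X ⟨r, by omega⟩ : MvPolynomial (Fin n) ℤ) = X ⟨r + 1, hr⟩ := by
  simp [simpleSwap]

theorem simpleSwap_X_right :
    simpleSwap r hr (X ⟨r + 1, hr⟩ : MvPolynomial (Fin n) ℤ) = X ⟨r, by omega⟩ := by
  simp [simpleSwap]

theorem X_sub_X_ne_zero :
    (X (⟨r, by omega⟩ : Fin n) - X ⟨r + 1, hr⟩ : MvPolynomial (Fin n) ℤ) ≠ 0 := by
  rw [sub_ne_zero]
  intro h
  simpa using X_injective h

/-- The defining property of the Demazure operator. -/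
theorem X_sub_X_mul_demazure (f : MvPolynomial (Fin n) ℤ) :
    (X (⟨r, by omega⟩ : Fin n) - X ⟨r + 1, hr⟩) * demazure r hr f =
      X ⟨r, by omega⟩ * f - X ⟨r + 1, hr⟩ * simpleSwap r hr f := by
  rw [demazure, ← dividedDiff_spec, simpleSwap_mul, simpleSwap_X_left]

theorem demazure_eq_iff (f g : MvPolynomial (Fin n) ℤ) :
    demazure r hr f = g ↔ X ⟨r, by omega⟩ * f - X ⟨r + 1, hr⟩ * simpleSwap r hr f =
      (X (⟨r, by omega⟩ : Fin n) - X ⟨r + 1, hr⟩) * g := by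
  rw [← X_sub_X_mul_demazure]
  exact (mul_right_injective₀ X_sub_X_ne_zero).eq_iff.symm

theorem demazure_add (f g : MvPolynomial (Fin n) ℤ) :
    demazure r hr (f + g) = demazure r hr f + demazure r hr g := by
  rw [demazure_eq_iff, mul_add _ (demazure r hr f), X_sub_X_mul_demazure, X_sub_X_mul_demazure]
  simp only [simpleSwap, map_add]
  ring

variable (r hr) in
/-- The Demazure operator as an additive homomorphism. -/
noncomputable def demazureHom : MvPolynomial (Fin n) ℤ →+ MvPolynomial (Fin n) ℤ :=
  AddMonoidHom.mk' (demazure r hr) demazure_add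

theorem demazureHom_apply (f : MvPolynomial (Fin n) ℤ) :
    demazureHom r hr f = demazure r hr f := rfl

theorem demazure_mul_of_symm {g : MvPolynomial (Fin n) ℤ} (hg : simpleSwap r hr g = g)
    (f : MvPolynomial (Fin n) ℤ) : demazure r hr (g * f) = g * demazure r hr f := by
  have h := X_sub_X_mul_demazure (hr := hr) f
  rw [demazure_eq_iff, simpleSwap_mul, hg]
  linear_combination -g * h

theorem demazure_of_symm {f : MvPolynomial (Fin n) ℤ} (hf : simpleSwap r hr f = f) :
    demazure r hr f = f := by
  rw [demazure_eq_iff, hf]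
  ring

theorem simpleSwap_demazure (f : MvPolynomial (Fin n) ℤ) :
    simpleSwap r hr (demazure r hr f) = demazure r hr f := by
  apply mul_right_injective₀ (X_sub_X_ne_zero (hr := hr))
  have h := congrArg (simpleSwap r hr) (X_sub_X_mul_demazure (hr := hr) f)
  have hs : ∀ f g : MvPolynomial (Fin n) ℤ,
      simpleSwap r hr (f - g) = simpleSwap r hr f - simpleSwap r hr g :=
    fun f g => map_sub _ f g
  simp only [simpleSwap_mul, hs, simpleSwap_X_left, simpleSwap_X_right,
    simpleSwap_simpleSwap] at h
  have h' := X_sub_X_mul_demazure (hr := hr) f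
  dsimp only
  linear_combination -h - h'

theorem demazure_demazure (f : MvPolynomial (Fin n) ℤ) :
    demazure r hr (demazure r hr f) = demazure r hr f :=
  demazure_of_symm (simpleSwap_demazure f)

/-- The twisted Leibniz rule; it treats a column in which a occurs without a + 1. -/
theorem demazure_X_mul (f : MvPolynomial (Fin n) ℤ) :
    demazure r hr (X ⟨r, by omega⟩ * f) =
      X ⟨r, by omega⟩ * f + X ⟨r + 1, hr⟩ * demazure r hr f := by
  have h := X_sub_X_mul_demazure (hr := hr) f
  rw [demazure_eq_iff, simpleSwap_mul, simpleSwap_X_left]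
  linear_combination -(X ⟨r + 1, hr⟩) * h

end Operator

/-! ### Consecutive columns

A column is a function on the rows with values in `ℕ`, where `0` stands for an empty box. -/

section Columns

variable {ι : Type*}

/-- `τ` may follow the column `σ` in a skyline filling: rows weakly decrease, and the triple
condition holds. -/
structure Follows [LT ι] (σ τ : ι → ℕ) : Prop where
  le : ∀ i, τ i ≤ σ i
  triple : ∀ i k, i < k → σ k ≠ 0 → σ k < σ i → σ k < τ i

/-- The nonempty entries of a column are distinct. -/
def IsDistinct (τ : ι → ℕ) : Prop := ∀ i k, τ i ≠ 0 → τ i = τ k → i = k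

/-- The transposition of the values `a` and `a + 1`. -/
def natSwap (a x : ℕ) : ℕ := if x = a then a + 1 else if x = a + 1 then a else x

/-- Neither `a` nor `a + 1` occurs. -/
def IsFree (a : ℕ) (τ : ι → ℕ) : Prop := ∀ i, τ i ≠ a ∧ τ i ≠ a + 1

/-- The value `a` occurs, and `a + 1` does not occur in a higher row. -/
def IsHead [LT ι] (a : ℕ) (τ : ι → ℕ) : Prop := ∃ p, τ p = a ∧ ∀ i, τ i = a + 1 → p < i

theorem natSwap_natSwap (a x : ℕ) : natSwap a (natSwap a x) = x := by
  unfold natSwap; grind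

theorem natSwap_eq_zero {a : ℕ} (ha : a ≠ 0) (x : ℕ) : natSwap a x = 0 ↔ x = 0 := by
  unfold natSwap; grind

theorem IsDistinct.natSwap {a : ℕ} (ha : a ≠ 0) {τ : ι → ℕ} (h : IsDistinct τ) :
    IsDistinct (fun i => natSwap a (τ i)) := by
  intro i k hi hik
  refine h i k (fun h0 => hi ((natSwap_eq_zero ha _).2 h0)) ?_
  rw [← natSwap_natSwap a (τ i), ← natSwap_natSwap a (τ k)]
  exact congrArg _ hik

variable [LinearOrder ι]

theorem not_isHead_of_isFree {a : ℕ} {τ : ι → ℕ} (h : IsFree a τ) : ¬ IsHead a τ :=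
  fun ⟨p, hp, _⟩ => (h p).1 hp

theorem not_isHead_natSwap {a : ℕ} {τ : ι → ℕ} (h : IsHead a τ) :
    ¬ IsHead a (fun i => natSwap a (τ i)) := by
  rintro ⟨q, hq, hq'⟩
  obtain ⟨p, hp, hp'⟩ := h
  have h1 := hp' q (by unfold natSwap at hq; grind)
  have h2 := hq' p (by unfold natSwap; grind)
  exact lt_asymm h1 h2

/-- Orbits of the value interchange on distinct columns are free fixed points or pairs with exactly
one head. -/
theorem isFree_or_isHead {a : ℕ} (τ : ι → ℕ) (hd : IsDistinct τ) (ha : a ≠ 0) :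
    IsFree a τ ∨ IsHead a τ ∨ IsHead a (fun i => natSwap a (τ i)) := by
  by_cases h1 : ∃ p, τ p = a
  · obtain ⟨p, hp⟩ := h1
    by_cases h2 : ∃ q, τ q = a + 1
    · obtain ⟨q, hq⟩ := h2
      rcases lt_trichotomy p q with h | h | h
      · exact Or.inr (Or.inl ⟨p, hp, fun i hi => by rwa [← hd q i (by omega) (by omega)]⟩)
      · subst h; omega
      · refine Or.inr (Or.inr ⟨q, by unfold natSwap; grind, fun i hi => ?_⟩)
        rwa [← hd p i (by omega) (by unfold natSwap at hi; grind)]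
    · exact Or.inr (Or.inl ⟨p, hp, fun i hi => (h2 ⟨i, hi⟩).elim⟩)
  · by_cases h2 : ∃ q, τ q = a + 1
    · obtain ⟨q, hq⟩ := h2
      exact Or.inr (Or.inr ⟨q, by unfold natSwap; grind,
        fun i hi => (h1 ⟨i, by unfold natSwap at hi; grind⟩).elim⟩)
    · exact Or.inl fun i => ⟨fun h => h1 ⟨i, h⟩, fun h => h2 ⟨i, h⟩⟩

/-- Comparison with entries of σ other than a and a + 1 cannot tell these two values apart. -/
theorem follows_natSwap_of_isFree {a : ℕ} {σ : ι → ℕ} (hσ : IsFree a σ) (τ : ι → ℕ) :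
    Follows σ (fun i => natSwap a (τ i)) ↔ Follows σ τ := by
  constructor
  · rintro ⟨h1, h2⟩
    refine ⟨fun i => ?_, fun i k hik h0 h => ?_⟩
    · have := h1 i; have := hσ i; unfold natSwap at *; grind
    · have := h2 i k hik h0 h; have := hσ k; unfold natSwap at *; grind
  · rintro ⟨h1, h2⟩
    refine ⟨fun i => ?_, fun i k hik h0 h => ?_⟩
    · have := h1 i; have := hσ i; unfold natSwap at *; grind
    · have := h2 i k hik h0 h; have := hσ k; unfold natSwap at *; grind

/-! ### The preceding column contains a but not a + 1. -/

section OnlyLower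

variable {a : ℕ} {σ τ : ι → ℕ} {p : ι}

/-- Raising a to a + 1 in σ matters only if τ has a + 1 in row p or above it. The head condition
then puts a in a still higher row of τ, where the triple condition with row p fails. -/
theorem follows_natSwap_left_iff (ha : a ≠ 0) (hσ : IsDistinct σ) (hp : σ p = a)
    (hn : ∀ i, σ i ≠ a + 1) (hτ : IsFree a τ ∨ IsHead a τ) :
    Follows (fun i => natSwap a (σ i)) τ ↔ Follows σ τ := by
  have hu : ∀ i, σ i = a → i = p := fun i hi => (hσ p i (by omega) (by omega)).symm
  constructor
  · rintro ⟨h1, h2⟩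
    refine ⟨fun i => ?_, fun i k hik h0 h => ?_⟩
    · have := h1 i; have := hn i
      unfold natSwap at *
      rcases hτ with hτ | ⟨q, hq, hq'⟩
      · have := hτ i; grind
      · have := h1 q; have := hu i; have := hu q; have := hq' i; have := hn q
        have h3 := h2 q i
        have h4 := h2 q p
        have h5 := h2 p q
        grind
    · have := h2 i k hik; have := hn k; have := hn i; have := hu i; have := hu k
      unfold natSwap at *
      grind
  · rintro ⟨h1, h2⟩
    refine ⟨fun i => ?_, fun i k hik h0 h => ?_⟩
    · have := h1 i; have := hn i; unfold natSwap; grind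
    · have h3 := h2 i k hik; have := hn k; have := hn i; have := hu i; have := hu k
      unfold natSwap at *
      rcases hτ with hτ | ⟨q, hq, hq'⟩
      · have := hτ i; grind
      · have := h1 q; have := hu q; have := hq' i; have := hn q
        have h5 := h2 q k
        grind

theorem follows_natSwap_natSwap_iff (ha : a ≠ 0) (hσ : IsDistinct σ) (hp : σ p = a)
    (hn : ∀ i, σ i ≠ a + 1) (hτ : IsHead a τ) (hd : IsDistinct τ) :
    Follows (fun i => natSwap a (σ i)) (fun i => natSwap a (τ i)) ↔ Follows σ τ := by
  have hu : ∀ i, σ i = a → i = p := fun i hi => (hσ p i (by omega) (by omega)).symm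
  obtain ⟨q, hq, hq'⟩ := hτ
  constructor
  · rintro ⟨h1, h2⟩
    refine ⟨fun i => ?_, fun i k hik h0 h => ?_⟩
    · have := h1 i; have := hn i
      unfold natSwap at *
      have := h1 q; have := hu i; have := hu q; have := hq' i; have := hn q
      have h4 := h2 q p
      have h5 := h2 p q
      grind
    · have := h2 i k hik; have := hn k; have := hn i; have := hu i; have := hu k
      unfold natSwap at *
      grind
  · rintro ⟨h1, h2⟩
    refine ⟨fun i => ?_, fun i k hik h0 h => ?_⟩
    · have := h1 i; have := hn i; unfold natSwap; grind
    · have h3 := h2 i k hik; have := hn k; have := hn i; have := hu i; have := hu k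
      have := h1 q; have := hu q; have := hq' i; have := hn q
      have := hd i q
      have h5 := h2 q k
      unfold natSwap at *
      grind

end OnlyLower

/-! ### The preceding column contains a, and a + 1 below it. -/

section Both

variable {a : ℕ} {σ τ : ι → ℕ} {p q : ι}

/-- After the interchange, the triple of rows p and q forces τ p = a + 1. A head then has a in a
higher row, violating the triple condition against row p. -/
theorem not_follows_natSwap (ha : a ≠ 0) (hσ : IsDistinct σ) (hp : σ p = a)
    (hq : σ q = a + 1) (hpq : p < q) (hτ : IsFree a τ ∨ IsHead a τ) :
    ¬ Follows (fun i => natSwap a (σ i)) τ := by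
  rintro ⟨h1, h2⟩
  have h3 := h2 p q hpq
  have h4 := h1 p
  unfold natSwap at *
  rcases hτ with hτ | ⟨t, ht, ht'⟩
  · have := hτ p; grind
  · have h5 := ht' p; have h6 := h2 t q; have h7 := h1 t; have h8 := h2 t p
    have h9 := hσ q t
    grind

/-- Following σ bounds row p by a, while the triple of the interchanged column forces an entry above
a there. So the alternatives of `follows_iff_or` are exclusive. -/
theorem not_follows_both (ha : a ≠ 0) (hp : σ p = a) (hq : σ q = a + 1) (hpq : p < q)
    (h : Follows σ (fun i => natSwap a (τ i))) :
    ¬ Follows (fun i => natSwap a (σ i)) (fun i => natSwap a (τ i)) := by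
  rintro ⟨h1, h2⟩
  have h3 := h2 p q hpq
  have h4 := h.le p
  unfold natSwap at *
  grind

theorem follows_iff_or (ha : a ≠ 0) (hσ : IsDistinct σ) (hp : σ p = a) (hq : σ q = a + 1)
    (hpq : p < q) (hτ : IsHead a τ) (hd : IsDistinct τ) :
    Follows σ τ ↔ Follows σ (fun i => natSwap a (τ i)) ∨
      Follows (fun i => natSwap a (σ i)) (fun i => natSwap a (τ i)) := by
  have hu : ∀ i, σ i = a → i = p := fun i hi => (hσ p i (by omega) (by omega)).symm
  have hv : ∀ i, σ i = a + 1 → i = q := fun i hi => (hσ q i (by omega) (by omega)).symm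
  obtain ⟨t, ht, ht'⟩ := hτ
  constructor
  · rintro ⟨h1, h2⟩
    -- The alternative is decided by whether a stays in its row p on passing from σ to τ.
    by_cases htp : t = p
    · subst htp
      refine Or.inr ⟨fun i => ?_, fun i k hik h0 h => ?_⟩
      · have := h1 i; have := hu i; have := hv i; have := hd i t; unfold natSwap; grind
      · have := h2 i k hik; have := hu i; have := hv i; have := hu k; have := hv k
        have := hd i t; have := ht' i; have := h2 i q
        unfold natSwap at *; grind
    · refine Or.inl ⟨fun i => ?_, fun i k hik h0 h => ?_⟩
      · have := h1 i; have := hu i; have := hv i; have := hd i t; have := ht' i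
        have := h1 t; have := h2 t q
        unfold natSwap; grind
      · have := h2 i k hik; have := hu i; have := hv i; have := hu k; have := hv k
        have := hd i t; have := ht' i; have := h2 i q; have := h1 t
        have := h2 t q
        unfold natSwap at *; grind
  · rintro (⟨h1, h2⟩ | ⟨h1, h2⟩)
    · refine ⟨fun i => ?_, fun i k hik h0 h => ?_⟩
      · have := h1 i; have := hu i; have := hv i; have := hd i t; have := ht' i
        have := h1 t; have := h2 t q
        unfold natSwap at *; grind
      · have := h2 i k hik; have := hu i; have := hv i; have := hu k; have := hv k
        have := hd i t; have := ht' i; have := h2 i q; have := h1 t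
        have := h2 t q
        unfold natSwap at *; grind
    · have h3 := h2 p q hpq
      have h4 := h1 p
      have htp : p = t := hd p t (by unfold natSwap at *; grind) (by unfold natSwap at *; grind)
      subst htp
      refine ⟨fun i => ?_, fun i k hik h0 h => ?_⟩
      · have := h1 i; have := hu i; have := hv i; have := hd i p; have := ht' i
        have := h2 i q; unfold natSwap at *; grind
      · have := h2 i k hik; have := hu i; have := hv i; have := hu k; have := hv k
        have := hd i p; have := ht' i; have := h2 i q; have := h2 i p
        unfold natSwap at *; grind

end Both

/-! ### Exchanging adjacent rows -/

section Rows

variable {p q : ι}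

theorem comp_swap_apply (σ : ι → ℕ) (i : ι) :
    (σ ∘ Equiv.swap p q) i = if i = p then σ q else if i = q then σ p else σ i := by
  rw [Function.comp_apply, Equiv.swap_apply_def]
  split_ifs <;> rfl

theorem adjacent_cases (hpq : p < q) (hadj : ∀ i, i ≠ p → i ≠ q → (i < p ↔ i < q)) (i : ι) :
    i = p ∨ i = q ∨ (i ≠ p ∧ i ≠ q ∧ i < p ∧ i < q ∧ ¬ p < i ∧ ¬ q < i) ∨
      (i ≠ p ∧ i ≠ q ∧ p < i ∧ q < i ∧ ¬ i < p ∧ ¬ i < q) := by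
  rcases lt_trichotomy i p with h | h | h
  · exact Or.inr (Or.inr (Or.inl ⟨h.ne, (h.trans hpq).ne, h, h.trans hpq, h.not_gt, (h.trans hpq).not_gt⟩))
  · exact Or.inl h
  · rcases lt_trichotomy i q with h' | h' | h'
    · exact absurd ((hadj i h.ne' h'.ne).2 h') h.not_gt
    · exact Or.inr (Or.inl h')
    · exact Or.inr (Or.inr (Or.inr ⟨h.ne', h'.ne', h, h', h.not_gt, h'.not_gt⟩))

/-- The order of two adjacent rows enters only through their mutual triple condition, which is
vacuous when one of them is empty. -/
theorem Follows.comp_swap (hpq : p < q) (hadj : ∀ i, i ≠ p → i ≠ q → (i < p ↔ i < q))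
    {σ τ : ι → ℕ} (hσ : σ p = 0 ∨ σ q = 0) (h : Follows σ τ) :
    Follows (σ ∘ Equiv.swap p q) (τ ∘ Equiv.swap p q) := by
  obtain ⟨h1, h2⟩ := h
  refine ⟨fun i => h1 _, fun i k hik h0 h => ?_⟩
  rw [comp_swap_apply] at h0 h ⊢
  rw [comp_swap_apply] at h ⊢
  have := adjacent_cases hpq hadj i; have := adjacent_cases hpq hadj k
  have := h2 i k; have := h2 i p; have := h2 i q; have := h2 p k; have := h2 q k
  grind

theorem follows_comp_swap_iff (hpq : p < q) (hadj : ∀ i, i ≠ p → i ≠ q → (i < p ↔ i < q))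
    {σ τ : ι → ℕ} (hσ : σ p = 0) :
    Follows (σ ∘ Equiv.swap p q) (τ ∘ Equiv.swap p q) ↔ Follows σ τ := by
  refine ⟨fun h => ?_, fun h => h.comp_swap hpq hadj (Or.inl hσ)⟩
  have h' := h.comp_swap hpq hadj (Or.inr (by simpa using hσ))
  simpa [Function.comp_assoc, ← Equiv.coe_trans] using h'

theorem follows_comp_swap_right_iff (hpq : p < q)
    (hadj : ∀ i, i ≠ p → i ≠ q → (i < p ↔ i < q)) {σ τ : ι → ℕ} (hσ0 : σ p ≠ 0)
    (hσ : σ p < σ q) (hτ : τ q < τ p) :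
    Follows σ (τ ∘ Equiv.swap p q) ↔ Follows σ τ ∨ Follows (σ ∘ Equiv.swap p q) τ := by
  constructor
  · rintro ⟨h1, h2⟩
    simp only [comp_swap_apply] at h1 h2
    -- The larger entry τ p either fits behind σ p, or fits only behind the larger σ q.
    by_cases hb : τ p ≤ σ p
    · refine Or.inl ⟨fun i => ?_, fun i k hik h0 h => ?_⟩
      · have := h1 p; have := h1 i; grind
      · have := h2 i k hik; have := h2 p k; have := h2 q k; have := adjacent_cases hpq hadj k
        grind
    · refine Or.inr ⟨fun i => ?_, fun i k hik h0 h => ?_⟩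
      · rw [comp_swap_apply]; have := h1 p; have := h1 q; have := h1 i; grind
      · rw [comp_swap_apply] at h0 h ⊢
        rw [comp_swap_apply] at h
        have := h2 i k hik; have := h2 p k; have := h2 q k; have := h2 i p; have := h2 i q
        have := adjacent_cases hpq hadj k; have := adjacent_cases hpq hadj i
        grind
  · rintro (⟨h1, h2⟩ | ⟨h1, h2⟩)
    · refine ⟨fun i => ?_, fun i k hik h0 h => ?_⟩
      · rw [comp_swap_apply]; have := h1 p; have := h1 q; have := h1 i; grind
      · rw [comp_swap_apply]
        have := h2 i k hik; have := h2 p k; have := h2 q k; have := h2 i p; have := h2 i q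
        have := adjacent_cases hpq hadj k; have := adjacent_cases hpq hadj i; have := h1 p
        grind
    · simp only [comp_swap_apply] at h1 h2
      refine ⟨fun i => ?_, fun i k hik h0 h => ?_⟩
      · rw [comp_swap_apply]; have := h1 p; have := h1 q; have := h1 i; grind
      · rw [comp_swap_apply]
        have := h2 i k hik; have := h2 p k; have := h2 q k; have := h2 i p; have := h2 i q
        have := adjacent_cases hpq hadj k; have := adjacent_cases hpq hadj i; have := h1 p; have := h2 p q hpq
        grind

/-- The triple of the interchanged rows gives σ p < τ p, whereas τ q ≤ σ p. -/
theorem not_follows_comp_swap_left (hpq : p < q) {σ τ : ι → ℕ} (hσ0 : σ p ≠ 0)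
    (hσ : σ p < σ q) (hτ : τ p < τ q) : ¬ Follows (σ ∘ Equiv.swap p q) τ := by
  rintro ⟨h1, h2⟩
  have h3 := h2 p q hpq
  have h4 := h1 q
  simp at h3 h4
  grind

theorem not_follows_and (hpq : p < q) {σ τ : ι → ℕ} (hσ0 : σ p ≠ 0) (hσ : σ p < σ q)
    (h : Follows σ τ) : ¬ Follows (σ ∘ Equiv.swap p q) τ := by
  rintro ⟨h1, h2⟩
  have h3 := h2 p q hpq
  have h4 := h.le p
  simp at h3
  grind

end Rows

end Columns

/-! ### Summing over the columns of a filling -/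

/-- A column of a filling with `n` rows, with `0` for an empty box. -/
abbrev Column (n : ℕ) : Type := Fin n → Fin (n + 1)

section ColumnPoly

variable {n : ℕ}

/-- The entries of a column as natural numbers. -/
def Column.entry (τ : Column n) (i : Fin n) : ℕ := τ i

/-- The variable of an entry, which is `1` for an empty box. -/
noncomputable def entryVar (x : Fin (n + 1)) : MvPolynomial (Fin n) ℤ :=
  Fin.cases (motive := fun _ => MvPolynomial (Fin n) ℤ) 1 X x

/-- The monomial of a column. -/
noncomputable def columnWeight (τ : Column n) : MvPolynomial (Fin n) ℤ := ∏ i, entryVar (τ i)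

/-- The column `τ` may follow the column `σ`, and it occupies the nonempty rows of a diagram with
row lengths `β`. -/
def IsStep (β : Fin n → ℕ) (σ τ : Column n) : Prop :=
  (∀ i, τ.entry i ≠ 0 ↔ β i ≠ 0) ∧ IsDistinct τ.entry ∧ Follows σ.entry τ.entry

open scoped Classical in
/-- The indicator of `IsStep`. -/
noncomputable def stepCount (β : Fin n → ℕ) (σ τ : Column n) : ℕ := if IsStep β σ τ then 1 else 0

open scoped Classical in
/-- The generating polynomial of the fillings with row lengths `β` whose columns, `m` in number
and the last one empty, follow the column `σ`. -/
noncomputable def columnPoly : ℕ → (Fin n → ℕ) → Column n → MvPolynomial (Fin n) ℤ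
  | 0, _, σ => if σ = 0 then 1 else 0
  | m + 1, β, σ =>
    ∑ τ : Column n, stepCount β σ τ • (columnWeight τ * columnPoly m (fun i => β i - 1) τ)

theorem stepCount_eq_zero {β : Fin n → ℕ} {σ τ : Column n} (h : ¬ IsStep β σ τ) :
    stepCount β σ τ = 0 := if_neg h

theorem stepCount_eq_of_iff {β γ : Fin n → ℕ} {σ σ' τ τ' : Column n}
    (h : IsStep β σ τ ↔ IsStep γ σ' τ') : stepCount β σ τ = stepCount γ σ' τ' := by
  by_cases h1 : IsStep γ σ' τ' <;> simp [stepCount, h, h1]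

theorem stepCount_eq_add {β γ δ : Fin n → ℕ} {σ₁ σ₂ σ₃ τ₁ τ₂ τ₃ : Column n}
    (h : IsStep β σ₁ τ₁ ↔ IsStep γ σ₂ τ₂ ∨ IsStep δ σ₃ τ₃)
    (h' : IsStep γ σ₂ τ₂ → ¬ IsStep δ σ₃ τ₃) :
    stepCount β σ₁ τ₁ = stepCount γ σ₂ τ₂ + stepCount δ σ₃ τ₃ := by
  unfold stepCount
  by_cases h1 : IsStep γ σ₂ τ₂
  · simp [h, h1, h' h1]
  · by_cases h2 : IsStep δ σ₃ τ₃ <;> simp [h, h1, h2]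

/-! ### Interchanging two values -/

section Values

variable {r : ℕ} {hr : r + 1 < n}

variable (r hr) in
/-- Interchange the entries `r + 1` and `r + 2` of a column. -/
def swapValues : Equiv.Perm (Column n) :=
  Equiv.piCongrRight fun _ => Equiv.swap (Fin.succ ⟨r, by omega⟩) (Fin.succ ⟨r + 1, hr⟩)

theorem swapValues_apply (τ : Column n) (i : Fin n) : swapValues r hr τ i =
    Equiv.swap (Fin.succ ⟨r, by omega⟩) (Fin.succ ⟨r + 1, hr⟩) (τ i) := rfl

theorem entry_swapValues (τ : Column n) :
    (swapValues r hr τ).entry = fun i => natSwap (r + 1) (τ.entry i) := by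
  funext i
  rw [Column.entry, swapValues_apply, Equiv.swap_apply_def, natSwap, Column.entry]
  simp only [Fin.ext_iff, Fin.val_succ]
  split_ifs <;> rfl

theorem swapValues_swapValues (τ : Column n) : swapValues r hr (swapValues r hr τ) = τ := by
  funext i
  simp [swapValues_apply]

theorem isDistinct_swapValues_iff (τ : Column n) :
    IsDistinct (swapValues r hr τ).entry ↔ IsDistinct τ.entry := by
  have h : ∀ τ : Column n, IsDistinct τ.entry → IsDistinct (swapValues r hr τ).entry :=
    fun τ h => by rw [entry_swapValues]; exact h.natSwap r.succ_ne_zero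
  exact ⟨fun h' => by simpa [swapValues_swapValues] using h _ h', h τ⟩

theorem simpleSwap_entryVar (x : Fin (n + 1)) : simpleSwap r hr (entryVar x) =
    entryVar (Equiv.swap (Fin.succ ⟨r, by omega⟩) (Fin.succ ⟨r + 1, hr⟩) x) := by
  cases x using Fin.cases with
  | zero =>
    rw [Equiv.swap_apply_of_ne_of_ne (Fin.succ_ne_zero _).symm (Fin.succ_ne_zero _).symm]
    simp [entryVar, simpleSwap]
  | succ i =>
    rw [← (Fin.succ_injective n).map_swap]
    simp [entryVar, simpleSwap]

theorem simpleSwap_columnWeight (τ : Column n) :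
    simpleSwap r hr (columnWeight τ) = columnWeight (swapValues r hr τ) := by
  unfold columnWeight
  rw [simpleSwap, map_prod]
  exact Finset.prod_congr rfl fun i _ => simpleSwap_entryVar (τ i)

theorem swapValues_eq_self {τ : Column n} (h : IsFree (r + 1) τ.entry) :
    swapValues r hr τ = τ := by
  funext i
  refine Equiv.swap_apply_of_ne_of_ne (fun h' => (h i).1 ?_) (fun h' => (h i).2 ?_) <;>
    simp [Column.entry, h']

/-- When both values occur, interchanging them only permutes the two rows that hold them. -/
theorem columnWeight_swapValues {τ : Column n} (hd : IsDistinct τ.entry) {p q : Fin n}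
    (hp : τ.entry p = r + 1) (hq : τ.entry q = r + 1 + 1) :
    columnWeight (swapValues r hr τ) = columnWeight τ := by
  have h : ∀ i, swapValues r hr τ i = τ (Equiv.swap p q i) := by
    intro i
    apply Fin.ext
    have e := congrFun (entry_swapValues (hr := hr) τ) i
    have h1 := hd p i
    have h2 := hd q i
    rw [Equiv.swap_apply_def]
    unfold Column.entry natSwap at *
    grind
  unfold columnWeight
  simp only [h]
  exact Equiv.prod_comp (Equiv.swap p q) fun i => entryVar (τ i)

/-- The Demazure operator on a sum over columns, when the summands behave like a column. -/
theorem demazure_sum {K : Column n → MvPolynomial (Fin n) ℤ} {T T' : Column n → ℕ}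
    (h0 : ∀ τ : Column n, IsDistinct τ.entry → IsFree (r + 1) τ.entry → demazure r hr (K τ) = K τ)
    (h1 : ∀ τ : Column n, IsDistinct τ.entry → IsHead (r + 1) τ.entry →
      demazure r hr (K τ) = K τ + K (swapValues r hr τ))
    (hT : ∀ τ : Column n, ¬ IsDistinct τ.entry → T τ = 0)
    (hT' : ∀ τ : Column n, ¬ IsDistinct τ.entry → T' τ = 0)
    (e1 : ∀ τ : Column n, IsDistinct τ.entry → IsFree (r + 1) τ.entry ∨ IsHead (r + 1) τ.entry →
      T' τ = T τ)
    (e2 : ∀ τ : Column n, IsDistinct τ.entry → IsHead (r + 1) τ.entry →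
      T' (swapValues r hr τ) = T τ) :
    demazure r hr (∑ τ, T τ • K τ) = ∑ τ, T' τ • K τ := by
  classical
  have h2 : ∀ τ : Column n, IsDistinct τ.entry → IsHead (r + 1) (swapValues r hr τ).entry →
      demazure r hr (K τ) = 0 := by
    -- Since π_r is idempotent, applying it to π_r K(sτ) = K(sτ) + K(τ) leaves π_r K(τ) = 0.
    intro τ hd hh
    have h := h1 _ ((isDistinct_swapValues_iff τ).2 hd) hh
    have h' := congrArg (demazure r hr) h
    rw [demazure_demazure, demazure_add, swapValues_swapValues] at h'
    simpa using h'
  -- `c` is the multiplicity with which the image of the term of τ contains K(τ), and `d` that of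
  -- K(sτ).
  let c : Column n → ℕ := fun τ =>
    if IsDistinct τ.entry ∧ (IsFree (r + 1) τ.entry ∨ IsHead (r + 1) τ.entry) then T τ else 0
  let d : Column n → ℕ := fun τ =>
    if IsDistinct τ.entry ∧ IsHead (r + 1) τ.entry then T τ else 0
  have hs := fun τ : Column n => entry_swapValues (hr := hr) τ
  have key : ∀ τ, T τ • demazure r hr (K τ) = c τ • K τ + d τ • K (swapValues r hr τ) := by
    intro τ
    by_cases hd : IsDistinct τ.entry
    · rcases isFree_or_isHead τ.entry hd r.succ_ne_zero with h | h | h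
      · have := not_isHead_of_isFree h
        simp [c, d, hd, h, this, h0 τ hd h]
      · simp [c, d, hd, h, h1 τ hd h]
      · have h3 : ¬ IsHead (r + 1) τ.entry := fun h' => not_isHead_natSwap h' h
        have h4 : ¬ IsFree (r + 1) τ.entry := fun h' => by
          rw [← hs τ, swapValues_eq_self h'] at h
          exact h3 h
        simp [c, d, hd, h3, h4, h2 τ hd (by rw [hs]; exact h)]
    · simp [c, d, hd, hT τ hd]
  have key' : ∀ τ, T' τ = c τ + d (swapValues r hr τ) := by
    intro τ
    by_cases hd : IsDistinct τ.entry
    · have hd' := (isDistinct_swapValues_iff (hr := hr) τ).2 hd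
      rcases isFree_or_isHead τ.entry hd r.succ_ne_zero with h | h | h
      · have := not_isHead_of_isFree h
        simp [c, d, hd, h, this, swapValues_eq_self h, e1 τ hd (Or.inl h)]
      · have h3 : ¬ IsHead (r + 1) (swapValues r hr τ).entry := by
          rw [hs]; exact not_isHead_natSwap h
        simp [c, d, hd, h, h3, e1 τ hd (Or.inr h)]
      · have h3 : ¬ IsHead (r + 1) τ.entry := fun h' => not_isHead_natSwap h' h
        rw [← hs τ] at h
        have h4 : ¬ IsFree (r + 1) τ.entry := fun h' => by
          rw [swapValues_eq_self h'] at h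
          exact h3 h
        have := e2 _ hd' h
        rw [swapValues_swapValues] at this
        simp [c, d, hd', h3, h4, h, this]
    · have hd' := (isDistinct_swapValues_iff (hr := hr) τ).not.2 hd
      simp [c, d, hd, hd', hT' τ hd]
  rw [← demazureHom_apply, map_sum]
  simp only [map_nsmul, demazureHom_apply, key, key', add_smul, Finset.sum_add_distrib]
  congr 1
  rw [← Equiv.sum_comp (swapValues r hr)]
  simp [swapValues_swapValues]

/-- The value interchange preserves support and distinctness, so only `Follows` has to be compared.
-/
theorem isStep_swapValues_iff_of {β : Fin n → ℕ} {σ σ' τ τ' : Column n}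
    (hτ : τ' = τ ∨ τ' = swapValues r hr τ)
    (h : IsDistinct τ.entry → (Follows σ'.entry τ'.entry ↔ Follows σ.entry τ.entry)) :
    IsStep β σ' τ' ↔ IsStep β σ τ := by
  have h1 : IsDistinct τ'.entry ↔ IsDistinct τ.entry := by
    rcases hτ with rfl | rfl
    · rfl
    · exact isDistinct_swapValues_iff τ
  have h2 : ∀ i, τ'.entry i = 0 ↔ τ.entry i = 0 := by
    rcases hτ with rfl | rfl
    · exact fun _ => Iff.rfl
    · exact fun i => by rw [entry_swapValues]; exact natSwap_eq_zero r.succ_ne_zero _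
  unfold IsStep
  simp only [ne_eq, h1, h2]
  tauto

theorem stepCount_of_not_isDistinct {β : Fin n → ℕ} {σ τ : Column n}
    (h : ¬ IsDistinct τ.entry) : stepCount β σ τ = 0 :=
  stepCount_eq_zero fun h' => h h'.2.1

/-- The Demazure operator on the generating polynomial of the fillings following a column. -/
theorem demazure_columnPoly (m : ℕ) : ∀ (β : Fin n → ℕ) (σ : Column n), IsDistinct σ.entry →
    (IsFree (r + 1) σ.entry → demazure r hr (columnPoly m β σ) = columnPoly m β σ) ∧
    ((∃ p, σ.entry p = r + 1) → (∀ i, σ.entry i ≠ r + 1 + 1) →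
      demazure r hr (columnPoly m β σ) = columnPoly m β (swapValues r hr σ)) ∧
    (∀ p q, σ.entry p = r + 1 → σ.entry q = r + 1 + 1 → p < q →
      demazure r hr (columnPoly m β σ) =
        columnPoly m β σ + columnPoly m β (swapValues r hr σ)) := by
  have ha : r + 1 ≠ 0 := r.succ_ne_zero
  have hs := fun τ : Column n => entry_swapValues (hr := hr) τ
  induction m with
  | zero =>
    intro β σ _
    have h1 : demazure r hr (1 : MvPolynomial (Fin n) ℤ) = 1 :=
      demazure_of_symm (by simp [simpleSwap])
    have h0 : demazure r hr (0 : MvPolynomial (Fin n) ℤ) = 0 := (demazureHom r hr).map_zero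
    have hne : ∀ {p}, σ.entry p = r + 1 → σ ≠ 0 ∧ swapValues r hr σ ≠ 0 := by
      intro p hp
      constructor <;> intro h
      · rw [h] at hp
        simp [Column.entry] at hp
      · have h2 := (natSwap_eq_zero ha (σ.entry p)).1 (by
          rw [← congrFun (hs σ) p, h]; rfl)
        omega
    refine ⟨fun _ => ?_, fun ⟨p, hp⟩ _ => ?_, fun p q hp _ _ => ?_⟩
    · by_cases h : σ = 0 <;> simp [columnPoly, h, h0, h1]
    · simp [columnPoly, hne hp, h0]
    · simp [columnPoly, hne hp, h0]
  | succ m ih =>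
    intro β σ hσ
    have k0 : ∀ τ : Column n, IsDistinct τ.entry → IsFree (r + 1) τ.entry →
        demazure r hr (columnWeight τ * columnPoly m (fun i => β i - 1) τ) =
          columnWeight τ * columnPoly m (fun i => β i - 1) τ := by
      intro τ hd h
      rw [demazure_mul_of_symm (by rw [simpleSwap_columnWeight, swapValues_eq_self h]),
        (ih _ τ hd).1 h]
    have k1 : ∀ τ : Column n, IsDistinct τ.entry → IsHead (r + 1) τ.entry →
        demazure r hr (columnWeight τ * columnPoly m (fun i => β i - 1) τ) =
          columnWeight τ * columnPoly m (fun i => β i - 1) τ +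
          columnWeight (swapValues r hr τ) *
            columnPoly m (fun i => β i - 1) (swapValues r hr τ) := by
      rintro τ hd ⟨p, hp, hp'⟩
      by_cases h2 : ∃ q, τ.entry q = r + 1 + 1
      · obtain ⟨q, hq⟩ := h2
        have hw := columnWeight_swapValues (hr := hr) hd hp hq
        rw [demazure_mul_of_symm (by rw [simpleSwap_columnWeight, hw]), hw,
          (ih _ τ hd).2.2 p q hp hq (hp' q hq), mul_add]
      -- The weight is x_r times a symmetric factor, and by induction π_r turns the continuation of
      -- τ into that of sτ.
      · have hn : ∀ i, τ.entry i ≠ r + 1 + 1 := fun i hi => h2 ⟨i, hi⟩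
        have e1 : entryVar (τ p) = X ⟨r, by omega⟩ := by
          rw [show τ p = Fin.succ ⟨r, by omega⟩ from Fin.ext hp]
          simp [entryVar]
        have e2 : entryVar (swapValues r hr τ p) = X ⟨r + 1, hr⟩ := by
          rw [show swapValues r hr τ p = Fin.succ ⟨r + 1, hr⟩ from Fin.ext (by
            have := congrFun (hs τ) p
            simpa [Column.entry, natSwap, show ((τ p : Fin (n + 1)) : ℕ) = r + 1 from hp]
              using this)]
          simp [entryVar]
        have e3 : ∀ i ∈ Finset.univ.erase p, swapValues r hr τ i = τ i := by
          intro i hi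
          refine Equiv.swap_apply_of_ne_of_ne (fun h' => (Finset.ne_of_mem_erase hi) ?_)
            (fun h' => hn i ?_)
          · exact (hd p i (by omega) (by rw [hp]; simp [Column.entry, h'])).symm
          · simp [Column.entry, h']
        have e4 : columnWeight τ = X ⟨r, by omega⟩ *
            ∏ i ∈ Finset.univ.erase p, entryVar (τ i) := by
          rw [columnWeight, ← Finset.mul_prod_erase _ _ (Finset.mem_univ p), e1]
        have e5 : columnWeight (swapValues r hr τ) = X ⟨r + 1, hr⟩ *
            ∏ i ∈ Finset.univ.erase p, entryVar (τ i) := by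
          rw [columnWeight, ← Finset.mul_prod_erase _ _ (Finset.mem_univ p), e2]
          congr 1
          exact Finset.prod_congr rfl fun i hi => by rw [e3 i hi]
        have e6 : simpleSwap r hr (∏ i ∈ Finset.univ.erase p, entryVar (τ i)) =
            ∏ i ∈ Finset.univ.erase p, entryVar (τ i) := by
          rw [simpleSwap, map_prod]
          exact Finset.prod_congr rfl fun i hi => by
            have := simpleSwap_entryVar (hr := hr) (τ i)
            rwa [← swapValues_apply, e3 i hi] at this
        rw [e4, e5, mul_comm (X _), mul_assoc, demazure_mul_of_symm e6, demazure_X_mul,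
          (ih _ τ hd).2.1 ⟨p, hp⟩ hn]
        ring
    refine ⟨fun h => ?_, fun ⟨p, hp⟩ hn => ?_, fun p q hp hq hpq => ?_⟩
    · refine demazure_sum k0 k1 (fun τ => stepCount_of_not_isDistinct)
        (fun τ => stepCount_of_not_isDistinct) (fun τ _ _ => rfl) (fun τ hd hτ => ?_)
      refine stepCount_eq_of_iff (isStep_swapValues_iff_of (Or.inr rfl) fun _ => ?_)
      rw [hs]
      exact follows_natSwap_of_isFree h _
    · refine demazure_sum k0 k1 (fun τ => stepCount_of_not_isDistinct)
        (fun τ => stepCount_of_not_isDistinct) (fun τ hd hτ => ?_) (fun τ hd hτ => ?_)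
      · refine stepCount_eq_of_iff
          (isStep_swapValues_iff_of (r := r) (hr := hr) (Or.inl rfl) fun _ => ?_)
        rw [hs]
        exact follows_natSwap_left_iff ha hσ hp hn hτ
      · refine stepCount_eq_of_iff (isStep_swapValues_iff_of (Or.inr rfl) fun _ => ?_)
        rw [hs, hs]
        exact follows_natSwap_natSwap_iff ha hσ hp hn hτ hd
    · have e : columnPoly (m + 1) β σ + columnPoly (m + 1) β (swapValues r hr σ) =
          ∑ τ : Column n, (stepCount β σ τ + stepCount β (swapValues r hr σ) τ) •
            (columnWeight τ * columnPoly m (fun i => β i - 1) τ) := by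
        simp only [columnPoly, add_smul, Finset.sum_add_distrib]
      rw [e]
      refine demazure_sum k0 k1 (fun τ => stepCount_of_not_isDistinct)
        (fun τ h => by simp [stepCount_of_not_isDistinct h])
        (fun τ hd hτ => ?_) (fun τ hd hτ => ?_)
      · rw [stepCount_eq_zero (σ := swapValues r hr σ), add_zero]
        intro h
        have h' := h.2.2
        rw [hs] at h'
        exact not_follows_natSwap ha hσ hp hq hpq hτ h'
      · have i0 := fun σ' => isStep_swapValues_iff_of (r := r) (hr := hr) (β := β) (σ := σ')
          (σ' := σ') (τ := swapValues r hr τ) (Or.inl rfl) fun _ => Iff.rfl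
        have i1 : ∀ i, (swapValues r hr τ).entry i = 0 ↔ τ.entry i = 0 := fun i => by
          rw [hs]; exact natSwap_eq_zero r.succ_ne_zero _
        have i2 := follows_iff_or ha hσ hp hq hpq hτ hd
        have i3 := not_follows_both (τ := τ.entry) ha hp hq hpq
        rw [← hs, ← hs] at i2
        rw [← hs, ← hs] at i3
        refine (stepCount_eq_add ?_ fun h h' => i3 h.2.2 h'.2.2).symm
        unfold IsStep
        simp only [ne_eq, i1, isDistinct_swapValues_iff, i2]
        tauto

end Values

end ColumnPoly

/-! ### Interchanging two adjacent rows -/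

section SwapRows

variable {n : ℕ} {p q : Fin n}

variable (p q) in
/-- Interchange two rows of a column. -/
def swapRows : Equiv.Perm (Column n) :=
  Function.Involutive.toPerm (fun τ => τ ∘ Equiv.swap p q) fun τ => by
    funext i
    simp

theorem entry_swapRows (τ : Column n) :
    (swapRows p q τ).entry = τ.entry ∘ Equiv.swap p q := rfl

theorem swapRows_swapRows (τ : Column n) : swapRows p q (swapRows p q τ) = τ :=
  (swapRows p q).left_inv τ

theorem columnWeight_swapRows (τ : Column n) :
    columnWeight (swapRows p q τ) = columnWeight τ :=
  Equiv.prod_comp (Equiv.swap p q) fun i => entryVar (τ i)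

theorem isDistinct_comp_swap_iff (τ : Fin n → ℕ) :
    IsDistinct (τ ∘ Equiv.swap p q) ↔ IsDistinct τ := by
  constructor
  · intro h i k hi hik
    have := h (Equiv.swap p q i) (Equiv.swap p q k) (by simpa using hi) (by simpa using hik)
    simpa using this
  · intro h i k hi hik
    simpa using h _ _ hi hik

theorem support_comp_swap_iff (β τ : Fin n → ℕ) :
    (∀ i, (τ ∘ Equiv.swap p q) i ≠ 0 ↔ (β ∘ Equiv.swap p q) i ≠ 0) ↔
      ∀ i, τ i ≠ 0 ↔ β i ≠ 0 :=
  (Equiv.swap p q).forall_congr_right (q := fun i => τ i ≠ 0 ↔ β i ≠ 0)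

/-- There are no fillings if an upper row is not longer than a lower one and starts with a larger
entry. -/
theorem columnPoly_eq_zero (hpq : p < q) (m : ℕ) : ∀ (β : Fin n → ℕ) (σ : Column n), β p ≤ β q →
    σ.entry q ≠ 0 → σ.entry q < σ.entry p → columnPoly m β σ = 0 := by
  induction m with
  | zero =>
    intro β σ _ hq _
    refine if_neg fun h => hq ?_
    rw [h]
    rfl
  | succ m ih =>
    intro β σ hβ hq hlt
    refine Finset.sum_eq_zero fun τ _ => ?_
    by_cases h : IsStep β σ τ
    · obtain ⟨h1, _, h3⟩ := h
      -- The inversion persists: τ q ≤ σ q < τ p, and row q, being at least as long as row p, is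
      -- still nonempty. It can therefore never reach the final empty column.
      have h4 := h3.triple p q hpq hq hlt
      have h5 := h3.le q
      have h6 := h1 p
      have h7 := h1 q
      rw [ih _ τ (by omega) (by omega) (by omega), mul_zero, smul_zero]
    · rw [stepCount_eq_zero h, zero_smul]

/-- Used once the shorter row is exhausted: an empty row imposes no condition, so its neighbour may
move past it. -/
theorem columnPoly_swapRows (hpq : p < q) (hadj : ∀ i, i ≠ p → i ≠ q → (i < p ↔ i < q)) (m : ℕ) :
    ∀ (β : Fin n → ℕ) (σ : Column n), β p = 0 → σ.entry p = 0 →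
      columnPoly m (β ∘ Equiv.swap p q) (swapRows p q σ) = columnPoly m β σ := by
  induction m with
  | zero =>
    intro β σ _ _
    have h : swapRows p q σ = 0 ↔ σ = 0 := by
      rw [← (swapRows p q).apply_eq_iff_eq (x := σ)]
      rfl
    exact if_congr h rfl rfl
  | succ m ih =>
    intro β σ hβ hσ
    rw [columnPoly, columnPoly, ← Equiv.sum_comp (swapRows p q)]
    refine Finset.sum_congr rfl fun τ _ => ?_
    have e : stepCount (β ∘ Equiv.swap p q) (swapRows p q σ) (swapRows p q τ) =
        stepCount β σ τ := by
      refine stepCount_eq_of_iff ?_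
      unfold IsStep
      rw [entry_swapRows, entry_swapRows, support_comp_swap_iff, isDistinct_comp_swap_iff,
        follows_comp_swap_iff hpq hadj hσ]
    rw [e, columnWeight_swapRows]
    by_cases h : IsStep β σ τ
    · have h1 := h.1 p
      rw [← ih (fun i => β i - 1) τ (by omega) (by omega)]
      rfl
    · rw [stepCount_eq_zero h, zero_smul, zero_smul]

/-- Interchanging a row with the longer row below it. -/
theorem columnPoly_eq_add (hpq : p < q) (hadj : ∀ i, i ≠ p → i ≠ q → (i < p ↔ i < q)) (m : ℕ) :
    ∀ (β : Fin n → ℕ) (σ : Column n), β p < β q → σ.entry p ≠ 0 → σ.entry p < σ.entry q →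
      columnPoly m β σ = columnPoly m (β ∘ Equiv.swap p q) σ +
        columnPoly m (β ∘ Equiv.swap p q) (swapRows p q σ) := by
  induction m with
  | zero =>
    intro β σ _ hp hlt
    have h : ∀ τ : Column n, (∃ i, τ.entry i ≠ 0) → τ ≠ 0 := by
      rintro τ ⟨i, hi⟩ rfl
      exact hi rfl
    have h2 := h σ ⟨p, hp⟩
    have h3 := h (swapRows p q σ) ⟨q, by simpa [entry_swapRows] using hp⟩
    simp [columnPoly, h2, h3]
  | succ m ih =>
    intro β σ hβ hp hlt
    set γ := β ∘ Equiv.swap p q with hγ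
    let K : Column n → MvPolynomial (Fin n) ℤ := fun τ =>
      columnWeight τ * columnPoly m (fun i => γ i - 1) τ
    have hγp : γ p = β q := by simp [hγ]
    have hγq : γ q = β p := by simp [hγ]
    have hγi : ∀ i, i ≠ p → i ≠ q → γ i = β i := fun i h1 h2 => by
      simp [hγ, Equiv.swap_apply_of_ne_of_ne h1 h2]
    -- By induction, a column increasing from row p to row q splits in two, and a decreasing one
    -- contributes nothing. If row p is already exhausted, only the interchanged term exists.
    have e1 : ∀ τ : Column n,
        stepCount β σ τ • (columnWeight τ * columnPoly m (fun i => β i - 1) τ) =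
        (if τ.entry p < τ.entry q then stepCount γ σ τ else 0) • K τ +
        (if τ.entry p < τ.entry q then stepCount β σ τ else 0) • K (swapRows p q τ) := by
      intro τ
      by_cases hβp : β p = 0
      · have h0 : (if τ.entry p < τ.entry q then stepCount γ σ τ else 0) = 0 := by
          split_ifs with h
          · refine stepCount_eq_zero fun h' => ?_
            have := h'.1 q
            omega
          · rfl
        rw [h0, zero_smul, zero_add]
        by_cases h : IsStep β σ τ
        · have h1 := h.1 p
          have h2 := h.1 q
          rw [if_pos (by omega)]
          simp only [K]
          rw [columnWeight_swapRows,
            ← columnPoly_swapRows hpq hadj m (fun i => β i - 1) τ (by omega) (by omega)]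
          rfl
        · simp [stepCount_eq_zero h]
      · have h3 : stepCount γ σ τ = stepCount β σ τ := by
          refine stepCount_eq_of_iff ?_
          have : ∀ i, γ i ≠ 0 ↔ β i ≠ 0 := by
            intro i
            by_cases hi : i = p
            · rw [hi, hγp]; omega
            · by_cases hi' : i = q
              · rw [hi', hγq]; omega
              · rw [hγi i hi hi']
          simp only [IsStep, this]
        rw [h3]
        by_cases h : IsStep β σ τ
        · have h1 := h.1 p
          have h2 := h.1 q
          rcases lt_trichotomy (τ.entry p) (τ.entry q) with hlt' | heq | hgt
          · rw [if_pos hlt', ih _ τ (by omega) (by omega) hlt', ← smul_add]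
            simp only [K]
            rw [columnWeight_swapRows, ← mul_add]
            rfl
          · exact absurd (h.2.1 p q (by omega) heq) hpq.ne
          · rw [if_neg (by omega), columnPoly_eq_zero hpq m _ τ _ _ hgt]
            · simp
            · omega
            · omega
        · simp [stepCount_eq_zero h]
    -- An increasing τ can follow only σ. A decreasing τ follows exactly one of σ and its row
    -- interchange precisely when the interchanged τ follows σ.
    have e2 : ∀ τ : Column n, stepCount γ σ τ + stepCount γ (swapRows p q σ) τ =
        (if τ.entry p < τ.entry q then stepCount γ σ τ else 0) +
        (if τ.entry q < τ.entry p then stepCount β σ (swapRows p q τ) else 0) := by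
      intro τ
      rcases lt_trichotomy (τ.entry p) (τ.entry q) with hlt' | heq | hgt
      · rw [if_pos hlt', if_neg (by omega), stepCount_eq_zero (σ := swapRows p q σ)]
        exact fun h => not_follows_comp_swap_left hpq hp hlt hlt' h.2.2
      · have h : ∀ σ', ¬ IsStep γ σ' τ := by
          intro σ' h
          have h1 := h.1 p
          exact hpq.ne (h.2.1 p q (by omega) heq)
        simp [heq, stepCount_eq_zero (h _)]
      · rw [if_pos hgt, if_neg (by omega), zero_add]
        refine (stepCount_eq_add ?_ ?_).symm
        · have h1 := support_comp_swap_iff (p := p) (q := q) γ τ.entry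
          have h2 : γ ∘ Equiv.swap p q = β := by
            funext i
            simp [hγ]
          rw [h2] at h1
          unfold IsStep
          rw [entry_swapRows, entry_swapRows, h1, isDistinct_comp_swap_iff,
            follows_comp_swap_right_iff hpq hadj hp hlt hgt]
          tauto
        · exact fun h h' => not_follows_and hpq hp hlt h.2.2 h'.2.2
    have e3 : columnPoly (m + 1) γ σ + columnPoly (m + 1) γ (swapRows p q σ) =
        ∑ τ : Column n, (stepCount γ σ τ + stepCount γ (swapRows p q σ) τ) • K τ := by
      simp only [columnPoly, add_smul, Finset.sum_add_distrib, K]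
    rw [e3, columnPoly]
    simp only [e1, e2, add_smul, Finset.sum_add_distrib]
    congr 1
    rw [← Equiv.sum_comp (swapRows p q)]
    simp [swapRows_swapRows, entry_swapRows]

end SwapRows

/-! ### Fillings as sequences of columns -/

section Fillings

variable {n : ℕ} {α : Fin n → ℕ}

/-- The basement. -/
def basement (n : ℕ) : Column n := Fin.succ

/-- The columns `c` extend the column `σ` to a filling with row lengths `β`, and the last one of
them is empty. -/
def IsChain {m : ℕ} (β : Fin n → ℕ) (σ : Column n) (c : Fin m → Column n) : Prop :=
  (∀ j : Fin m, IsStep (fun i => β i - j)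
    ((Fin.cons σ c : Fin (m + 1) → Column n) j.castSucc) (c j)) ∧
  (Fin.cons σ c : Fin (m + 1) → Column n) (Fin.last m) = 0

theorem isChain_cons_iff {m : ℕ} (β : Fin n → ℕ) (σ τ : Column n) (c : Fin m → Column n) :
    IsChain β σ (Fin.cons τ c : Fin (m + 1) → Column n) ↔
      IsStep β σ τ ∧ IsChain (fun i => β i - 1) τ c := by
  unfold IsChain
  rw [Fin.forall_fin_succ, ← Fin.succ_last]
  simp only [Fin.cons_succ, Fin.cons_zero, Fin.castSucc_zero, Fin.val_zero, Fin.val_succ,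
    ← Fin.succ_castSucc, Nat.sub_zero, Nat.sub_sub, Nat.add_comm 1, and_assoc]

open scoped Classical in
theorem columnPoly_eq_sum (m : ℕ) : ∀ (β : Fin n → ℕ) (σ : Column n), columnPoly m β σ =
    ∑ c : Fin m → Column n with IsChain β σ c, ∏ j, columnWeight (c j) := by
  induction m with
  | zero =>
    intro β σ
    rw [Finset.sum_filter, Fintype.sum_unique]
    have h : ∀ c : Fin 0 → Column n, IsChain β σ c ↔ σ = 0 := by
      simp [IsChain]
    by_cases hσ : σ = 0
    · rw [if_pos ((h _).2 hσ)]
      simp [columnPoly, hσ]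
    · rw [if_neg ((h _).not.2 hσ)]
      simp [columnPoly, hσ]
  | succ m ih =>
    intro β σ
    rw [Finset.sum_filter, ← Equiv.sum_comp (Fin.consEquiv fun _ => Column n),
      Fintype.sum_prod_type, columnPoly]
    refine Finset.sum_congr rfl fun τ _ => ?_
    rw [ih, Finset.sum_filter, Finset.mul_sum, Finset.smul_sum]
    refine Finset.sum_congr rfl fun c _ => ?_
    have hc : IsChain β σ (Fin.consEquiv (fun _ => Column n) (τ, c)) ↔
        IsStep β σ τ ∧ IsChain (fun i => β i - 1) τ c := isChain_cons_iff β σ τ c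
    simp only [Fin.consEquiv_apply, Fin.prod_univ_succ, Fin.cons_zero, Fin.cons_succ]
    by_cases h : IsStep β σ τ
    · by_cases h' : IsChain (fun i => β i - 1) τ c
      · rw [if_pos h', if_pos (hc.2 ⟨h, h'⟩)]
        simp [stepCount, h]
      · rw [if_neg h', if_neg fun h'' => h' (hc.1 h'').2]
        simp
    · rw [if_neg fun h'' => h (hc.1 h'').1]
      simp [stepCount, h]

/-- The columns of a filling. -/
def fillingColumn (F : Filling α) (j : ℕ) : Column n :=
  fun i => if h : j < α i then (F i ⟨j, h⟩).succ else 0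

theorem entry_fillingColumn_of_lt (F : Filling α) {i : Fin n} {j : ℕ} (h : j < α i) :
    (fillingColumn F j).entry i = F i ⟨j, h⟩ + 1 := by
  simp [fillingColumn, Column.entry, h]

theorem entry_fillingColumn_of_le (F : Filling α) {i : Fin n} {j : ℕ} (h : α i ≤ j) :
    (fillingColumn F j).entry i = 0 := by
  simp [fillingColumn, Column.entry, h.not_gt]

theorem row_of_succ {F : Filling α}
    (h : ∀ (i : Fin n) (j : ℕ) (hj : j + 1 < α i), F i ⟨j + 1, hj⟩ ≤ F i ⟨j, by omega⟩)
    (i : Fin n) (j k : Fin (α i)) (hjk : j ≤ k) : F i k ≤ F i j := by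
  obtain ⟨j, hj⟩ := j
  obtain ⟨k, hk⟩ := k
  have hjk' : j ≤ k := hjk
  clear hjk
  induction k, hjk' using Nat.le_induction with
  | base => exact le_rfl
  | succ k _ ih => exact (h i k hk).trans (ih (by omega))

theorem cons_fillingColumn_castSucc {m : ℕ} (F : Filling α) (j : Fin m) :
    (Fin.cons (basement n) (fun k : Fin m => fillingColumn F k) : Fin (m + 1) → Column n)
      j.castSucc = if (j : ℕ) = 0 then basement n else fillingColumn F (j - 1) := by
  obtain ⟨j, hj⟩ := j
  cases j with
  | zero => rfl
  | succ j => rfl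

/-- Because an empty box has value 0, the inequality in `Follows.triple` also contains the existence
of the entry c. The strict bound `hm` makes the last column empty. -/
theorem isChain_fillingColumn_iff {m : ℕ} (hm : ∀ i, α i < m) (hm0 : m ≠ 0) (F : Filling α) :
    IsChain α (basement n) (fun j : Fin m => fillingColumn F j) ↔ IsSSF α F := by
  constructor
  · rintro ⟨h, -⟩
    have h0 : ∀ (i : Fin n) (hi : 0 < α i), F i ⟨0, hi⟩ ≤ i := by
      intro i hi
      have := (h ⟨0, by omega⟩).2.2.le i
      rw [cons_fillingColumn_castSucc, if_pos rfl, entry_fillingColumn_of_lt F hi] at this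
      exact Fin.le_def.2 (Nat.le_of_succ_le_succ this)
    have hs : ∀ (j : ℕ) (hj : j + 1 < m),
        Follows (fillingColumn F j).entry (fillingColumn F (j + 1)).entry := by
      intro j hj
      have := (h ⟨j + 1, hj⟩).2.2
      rwa [cons_fillingColumn_castSucc] at this
    have hr : ∀ (i : Fin n) (j : ℕ) (hj : j + 1 < α i),
        F i ⟨j + 1, hj⟩ ≤ F i ⟨j, by omega⟩ := by
      intro i j hj
      have := (hs j (hj.trans (hm i))).le i
      rw [entry_fillingColumn_of_lt F hj, entry_fillingColumn_of_lt F (by omega)] at this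
      exact Fin.le_def.2 (by omega)
    refine ⟨row_of_succ hr, fun i j => ?_, fun i i' j hi hi' hne he => ?_,
      fun i i' j hi hi' hlt hF => ?_⟩
    · exact (row_of_succ hr i ⟨0, j.pos⟩ j (Nat.zero_le _)).trans (h0 i _)
    · refine hne ((h ⟨j, hi.trans (hm i)⟩).2.1 i i' ?_ ?_)
      · exact (entry_fillingColumn_of_lt F hi).trans_ne (Nat.succ_ne_zero _)
      · exact (entry_fillingColumn_of_lt F hi).trans
          ((congrArg (fun x : Fin n => (x : ℕ) + 1) he).trans (entry_fillingColumn_of_lt F hi').symm)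
    · have := hm i
      have h1 := (hs j (by omega)).triple i i' hlt
      rw [entry_fillingColumn_of_lt F hi, entry_fillingColumn_of_lt F hi'] at h1
      have h2 := h1 (by omega) (by have := Fin.lt_def.1 hF; omega)
      by_cases hc : j + 1 < α i
      · rw [entry_fillingColumn_of_lt F hc] at h2
        exact ⟨hc, Fin.lt_def.2 (by omega)⟩
      · rw [entry_fillingColumn_of_le F (by omega)] at h2
        omega
  · intro h
    refine ⟨fun j => ⟨fun i => ?_, fun i k hi hik => ?_, ?_⟩, ?_⟩
    · by_cases hj : (j : ℕ) < α i
      · rw [entry_fillingColumn_of_lt F hj]; dsimp only; omega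
      · rw [entry_fillingColumn_of_le F (by omega)]; dsimp only; omega
    · by_contra hne
      have hi' : (j : ℕ) < α i := by
        by_contra hj
        exact hi (entry_fillingColumn_of_le F (by omega))
      have hk' : (j : ℕ) < α k := by
        by_contra hj
        exact hi (hik.trans (entry_fillingColumn_of_le F (by omega)))
      rw [entry_fillingColumn_of_lt F hi', entry_fillingColumn_of_lt F hk'] at hik
      exact h.column i k j hi' hk' hne (Fin.ext (by omega))
    · rw [cons_fillingColumn_castSucc]
      obtain ⟨j, hj⟩ := j
      cases j with
      | zero =>
        refine ⟨fun i => ?_, fun i k hik _ hlt => ?_⟩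
        · by_cases hi : 0 < α i
          · have := Fin.le_def.1 (h.flag i ⟨0, hi⟩)
            rw [entry_fillingColumn_of_lt F hi]
            exact Nat.succ_le_succ this
          · simp [entry_fillingColumn_of_le F (not_lt.1 hi)]
        -- The basement increases downwards, so its triple condition is vacuous.
        · simp only [↓reduceIte, basement, Column.entry, Fin.val_succ] at hlt
          have := Fin.lt_def.1 hik
          omega
      | succ j =>
        simp only [Nat.add_eq_zero_iff, one_ne_zero, and_false, ↓reduceIte,
          Nat.add_sub_cancel]
        refine ⟨fun i => ?_, fun i k hik h0 hlt => ?_⟩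
        · by_cases hi : j + 1 < α i
          · rw [entry_fillingColumn_of_lt F hi, entry_fillingColumn_of_lt F (by omega)]
            exact Nat.succ_le_succ (Fin.le_def.1 (h.row i ⟨j, by omega⟩ ⟨j + 1, hi⟩
              (Nat.le_succ j)))
          · simp [entry_fillingColumn_of_le F (not_lt.1 hi)]
        · have hk : j < α k := by
            by_contra hj
            exact h0 (entry_fillingColumn_of_le F (by omega))
          have hi : j < α i := by
            by_contra hj
            rw [entry_fillingColumn_of_le F (i := i) (by omega)] at hlt
            omega
          rw [entry_fillingColumn_of_lt F hi, entry_fillingColumn_of_lt F hk] at hlt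
          obtain ⟨hc, hc'⟩ := h.triple i k j hi hk hik (Fin.lt_def.2 (by omega))
          rw [entry_fillingColumn_of_lt F hk, entry_fillingColumn_of_lt F hc]
          exact Nat.succ_lt_succ (Fin.lt_def.1 hc')
    · obtain ⟨m, rfl⟩ := Nat.exists_eq_succ_of_ne_zero hm0
      rw [Nat.succ_eq_add_one, ← Fin.succ_last, Fin.cons_succ]
      funext i
      exact dif_neg (by have := hm i; simp; omega)

theorem prod_columnWeight_fillingColumn {m : ℕ} (hm : ∀ i, α i < m) (F : Filling α) :
    ∏ j : Fin m, columnWeight (fillingColumn F j) = weight ℤ F := by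
  unfold columnWeight weight
  rw [Finset.prod_comm]
  refine Finset.prod_congr rfl fun i _ => ?_
  rw [Fin.prod_univ_eq_prod_range (fun j => entryVar (fillingColumn F j i)) m,
    ← Finset.prod_subset (Finset.range_subset_range.2 (hm i).le),
    ← Fin.prod_univ_eq_prod_range (fun j => entryVar (fillingColumn F j i)) (α i)]
  · refine Finset.prod_congr rfl fun j _ => ?_
    simp [fillingColumn, entryVar]
  · intro j _ hj
    rw [fillingColumn, dif_neg (by simpa using hj)]
    simp [entryVar]

/-- The generating polynomial of the semistandard skyline fillings, summed column by column. -/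
theorem ssfPoly_eq_columnPoly {m : ℕ} (hm : ∀ i, α i < m) (hm0 : m ≠ 0) :
    ssfPoly α = columnPoly m α (basement n) := by
  classical
  rw [columnPoly_eq_sum, ssfPoly]
  refine Finset.sum_bij (fun F _ (j : Fin m) => fillingColumn F j) ?_ ?_ ?_ ?_
  · intro F hF
    simpa [isChain_fillingColumn_iff hm hm0] using hF
  · intro F _ G _ h
    funext i j
    have h' := congrFun (congrFun h ⟨j, j.2.trans (hm i)⟩) i
    simpa [fillingColumn] using h'
  · intro c hc
    have hc' := (Finset.mem_filter.1 hc).2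
    have hs : ∀ (j : Fin m) (i : Fin n), c j i ≠ 0 ↔ (j : ℕ) < α i := by
      intro j i
      have := (hc'.1 j).1 i
      simp only [Column.entry, ne_eq, Fin.val_eq_zero_iff] at this
      rw [ne_eq, this]
      omega
    let F : Filling α := fun i j => (c ⟨j, j.2.trans (hm i)⟩ i).pred ((hs _ i).2 j.2)
    have hF : (fun j : Fin m => fillingColumn F j) = c := by
      funext j i
      by_cases h : (j : ℕ) < α i
      · simp [fillingColumn, h, F]
      · rw [fillingColumn, dif_neg h]
        exact (not_not.1 ((hs j i).not.2 h)).symm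
    refine ⟨F, ?_, hF⟩
    rw [← hF, isChain_fillingColumn_iff hm hm0] at hc'
    simpa using hc'
  · intro F _
    exact (prod_columnWeight_fillingColumn hm F).symm

/-- The Demazure operator at any ascent. -/
theorem demazure_ssfPoly (α : Fin n → ℕ) (r : ℕ) (hr : r + 1 < n)
    (h : α ⟨r, by omega⟩ < α ⟨r + 1, hr⟩) :
    demazure r hr (ssfPoly (swapParts r hr α)) = ssfPoly α := by
  set p : Fin n := ⟨r, by omega⟩ with hp
  set q : Fin n := ⟨r + 1, hr⟩ with hq
  -- One number of columns that serves both α and the composition with two parts swapped.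
  have hm : ∀ i, α i < ∑ k, α k + 1 := fun i =>
    Nat.lt_succ_of_le (Finset.single_le_sum (fun _ _ => Nat.zero_le _) (Finset.mem_univ i))
  have hm' : ∀ i, swapParts r hr α i < ∑ k, α k + 1 := fun i => hm _
  have hpq : p < q := Fin.lt_def.2 (Nat.lt_succ_self r)
  have hadj : ∀ i, i ≠ p → i ≠ q → (i < p ↔ i < q) := by
    intro i h1 h2
    simp only [hp, hq, ne_eq, Fin.ext_iff, Fin.lt_def] at *
    omega
  have hd : IsDistinct (basement n).entry := by
    intro i k _ hik
    simpa [basement, Column.entry, Fin.ext_iff] using hik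
  have hv : swapValues r hr (basement n) = swapRows p q (basement n) := by
    funext i
    exact ((Fin.succ_injective n).map_swap p q i).symm
  rw [ssfPoly_eq_columnPoly hm (Nat.succ_ne_zero _),
    ssfPoly_eq_columnPoly hm' (Nat.succ_ne_zero _),
    columnPoly_eq_add hpq hadj _ α _ h (by simp [basement, Column.entry])
      (by simp [basement, Column.entry, hp, hq]),
    (demazure_columnPoly _ _ _ hd).2.2 p q (by simp [basement, Column.entry, hp])
      (by simp [basement, Column.entry, hq]) hpq, hv]
  rfl

end Fillings

/-! ### Specializing the Haglund–Haiman–Loehr formula -/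

section Macdonald

variable {n : ℕ} {α : Fin n → ℕ} {F : Filling α}

theorem augFilling_succ (F : Filling α) (i : Fin n) (j : ℕ) (h : j + 1 < α i + 1) :
    augFilling F ⟨i, ⟨j + 1, h⟩⟩ = F i ⟨j, by omega⟩ := rfl

theorem maj_eq_zero_iff (F : Filling α) :
    maj F = 0 ↔ ∀ u : Box α, F u.1 u.2 ≤ augFilling F u.left := by
  rw [maj, Finset.sum_eq_zero_iff]
  refine ⟨fun h u => not_lt.1 fun hu => ?_, fun h u hu => ?_⟩
  · exact absurd (h u (Finset.mem_filter.2 ⟨Finset.mem_univ u, hu⟩)) (Nat.succ_ne_zero _)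
  · exact absurd (Finset.mem_filter.1 hu).2 (h u).not_gt

theorem coinv_eq_zero_iff (F : Filling α) : coinv F = 0 ↔ ∀ u : Box α, ∀ v ∈ arm u,
    ¬ CyclicLT (F u.1 u.2) (augFilling F v) (augFilling F u.left) := by
  rw [coinv, Finset.sum_eq_zero_iff]
  simp only [Finset.mem_univ, forall_const, Finset.card_eq_zero]
  classical
  exact forall_congr' fun u => Finset.filter_eq_empty_iff

theorem cyclicLT_iff_of_le {a b c : Fin n} (h : a ≤ c) : CyclicLT a b c ↔ a < b ∧ b < c := by
  unfold CyclicLT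
  constructor
  · rintro (h' | h' | h')
    · exact h'
    · exact absurd h'.2 h.not_gt
    · exact absurd h'.1 h.not_gt
  · exact Or.inl

/-- In a semistandard skyline filling, a row that is not longer than a lower one has the smaller
entries. -/
theorem IsSSF.lt_of_length_le (h : IsSSF α F) {i k : Fin n} (hik : i < k) (hα : α i ≤ α k)
    (j : ℕ) (hi : j < α i) : F i ⟨j, hi⟩ < F k ⟨j, by omega⟩ := by
  by_contra hlt
  have h0 := lt_of_le_of_ne (not_lt.1 hlt) (h.column k i j (by omega) hi hik.ne')
  -- The triple condition propagates the inversion to the right, past the end of the shorter row.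
  have key : ∀ d, ∃ hd : j + d < α i, F k ⟨j + d, by omega⟩ < F i ⟨j + d, hd⟩ := by
    intro d
    induction d with
    | zero => exact ⟨hi, h0⟩
    | succ d ih =>
      obtain ⟨hd, hlt⟩ := ih
      obtain ⟨hc, hlt'⟩ := h.triple i k (j + d) hd (by omega) hik hlt
      exact ⟨hc, lt_of_le_of_lt (h.row k ⟨j + d, by omega⟩ ⟨j + (d + 1), by omega⟩
        (Nat.le_succ _)) hlt'⟩
  obtain ⟨hd, -⟩ := key (α i)
  omega

theorem IsSSF.isNonAttacking (h : IsSSF α F) : IsNonAttacking F := by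
  rintro ⟨i, j, hj⟩ ⟨k, l, hl⟩ (⟨hne, he⟩ | ⟨hlt, he⟩)
  · simp only at hne he
    subst he
    cases j with
    | zero => exact hne
    | succ j => exact h.column i k j _ _ hne
  · simp only at hlt he
    subst he
    rw [augFilling_succ]
    cases j with
    | zero => exact (lt_of_le_of_lt (h.flag k _) hlt).ne'
    | succ j =>
      rw [augFilling_succ]
      intro he
      have h1 : F i ⟨j, by omega⟩ ≤ F k ⟨j, by omega⟩ := by
        rw [he]
        exact h.row k ⟨j, by omega⟩ ⟨j + 1, by omega⟩ (Nat.le_succ j)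
      have h2 := lt_of_le_of_ne h1 (h.column i k j (by omega) (by omega) hlt.ne')
      obtain ⟨hc, h3⟩ := h.triple k i j (by omega) (by omega) hlt h2
      exact h3.ne he

theorem IsSSF.le_left (h : IsSSF α F) (u : Box α) : F u.1 u.2 ≤ augFilling F u.left := by
  obtain ⟨i, j, hj⟩ := u
  cases j with
  | zero => exact h.flag i _
  | succ j => exact h.row i ⟨j, by omega⟩ ⟨j + 1, hj⟩ (Nat.le_succ j)

theorem IsSSF.coinv_eq_zero (h : IsSSF α F) : coinv F = 0 := by
  rw [coinv_eq_zero_iff]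
  intro u v hv hc
  rw [cyclicLT_iff_of_le (h.le_left u)] at hc
  obtain ⟨hc, hc'⟩ := hc
  obtain ⟨i, j, hj⟩ := u
  obtain ⟨k, l, hl⟩ := v
  simp only [arm, Finset.mem_filter_univ] at hv
  rcases hv with ⟨hki, hα, he⟩ | ⟨hik, hα, he⟩
  · subst he
    rw [augFilling_succ] at hc
    exact hc.asymm (h.lt_of_length_le hki hα j (by omega))
  · subst he
    cases l with
    | zero => exact hik.asymm hc'
    | succ l =>
      rw [augFilling_succ] at hc hc'
      obtain ⟨_, h3⟩ := h.triple i k l (by omega) (by omega) hik hc'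
      exact lt_asymm h3 hc

/-- With weakly decreasing rows the cyclic condition reduces to a < b < c. Arm boxes in the same
column order the entries when the upper row is not longer; arm boxes in the preceding column give
the triple condition when it is longer. -/
theorem isSSF_of_coinv_eq_zero (hN : IsNonAttacking F)
    (hM : ∀ u : Box α, F u.1 u.2 ≤ augFilling F u.left) (hC : coinv F = 0) : IsSSF α F := by
  rw [coinv_eq_zero_iff] at hC
  have hrow := row_of_succ fun i j hj => hM ⟨i, ⟨j + 1, hj⟩⟩
  have hcol : ∀ (i i' : Fin n) (j : ℕ) (h : j < α i) (h' : j < α i'), i ≠ i' →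
      F i ⟨j, h⟩ ≠ F i' ⟨j, h'⟩ := fun i i' j h h' hne =>
    hN ⟨i, ⟨j + 1, by omega⟩⟩ ⟨i', ⟨j + 1, by omega⟩⟩ (Or.inl ⟨hne, rfl⟩)
  have hlt : ∀ (i k : Fin n) (_ : i < k) (_ : α i ≤ α k) (j : ℕ) (hi : j < α i),
      F i ⟨j, hi⟩ < F k ⟨j, by omega⟩ := by
    intro i k hik hα j hi
    have key : ∀ (j : ℕ) (hi : j < α i),
        F i ⟨j, hi⟩ < augFilling F (Box.left ⟨k, ⟨j, by omega⟩⟩) → F i ⟨j, hi⟩ < F k ⟨j, by omega⟩ := by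
      intro j hi hw
      have h1 := hC ⟨k, ⟨j, by omega⟩⟩ ⟨i, ⟨j + 1, by omega⟩⟩
        (by simp [arm, hik, hα])
      rw [cyclicLT_iff_of_le (hM _)] at h1
      exact lt_of_le_of_ne (not_lt.1 fun h2 => h1 ⟨h2, hw⟩) (hcol i k j hi _ hik.ne)
    induction j with
    | zero => exact key 0 hi (lt_of_le_of_lt (hM ⟨i, ⟨0, hi⟩⟩) hik)
    | succ j ih => exact key _ hi (lt_of_le_of_lt (hM ⟨i, ⟨j + 1, hi⟩⟩) (ih (by omega) key))
  refine ⟨hrow, fun i j => ?_, hcol, fun i k j hi hk hik hF => ?_⟩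
  · exact (hrow i ⟨0, j.pos⟩ j (Nat.zero_le _)).trans (hM ⟨i, ⟨0, j.pos⟩⟩)
  · rcases le_or_gt (α i) (α k) with hα | hα
    · exact absurd (hlt i k hik hα j hi) hF.asymm
    · refine ⟨by omega, ?_⟩
      have h1 := hC ⟨i, ⟨j + 1, by omega⟩⟩ ⟨k, ⟨j + 1, by omega⟩⟩
        (by simp [arm, hik, hα])
      rw [cyclicLT_iff_of_le (hM _)] at h1
      refine lt_of_le_of_ne (not_lt.1 fun h2 => h1 ⟨h2, hF⟩) ?_
      -- Coinversions give only a ≤ c; equality would be an attack between consecutive columns.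
      exact hN ⟨k, ⟨j + 1, by omega⟩⟩ ⟨i, ⟨j + 1 + 1, by omega⟩⟩ (Or.inr ⟨hik, rfl⟩)

/-- The fillings that contribute to the Haglund–Haiman–Loehr formula at `q = t = 0`. -/
theorem isSSF_iff (F : Filling α) : IsSSF α F ↔ IsNonAttacking F ∧ maj F = 0 ∧ coinv F = 0 := by
  rw [maj_eq_zero_iff]
  exact ⟨fun h => ⟨h.isNonAttacking, h.le_left, h.coinv_eq_zero⟩,
    fun ⟨h1, h2, h3⟩ => isSSF_of_coinv_eq_zero h1 h2 h3⟩

theorem map_weight {R S : Type*} [CommSemiring R] [CommSemiring S] (f : R →+* S)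
    (F : Filling α) : map f (weight R F) = weight S F := by
  simp [weight, map_prod]

theorem macdonaldE_zero_zero (α : Fin n → ℕ) :
    macdonaldE α (0 : ℚ) 0 = map (Int.castRingHom ℚ) (ssfPoly α) := by
  classical
  rw [ssfPoly, map_sum, macdonaldE, Finset.sum_filter, Finset.sum_filter]
  refine Finset.sum_congr rfl fun F _ => ?_
  rw [map_weight]
  by_cases h : IsSSF α F
  · obtain ⟨h1, h2, h3⟩ := (isSSF_iff F).1 h
    rw [if_pos h, if_pos h1, h2, h3]
    -- Here 0 ^ 0 = 1, and every factor of the product is 1 because its exponents are positive.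
    simp
  · rw [if_neg h]
    split_ifs with h1
    · have h2 : maj F ≠ 0 ∨ coinv F ≠ 0 := by
        by_contra h2
        rw [not_or, not_not, not_not] at h2
        exact h ((isSSF_iff F).2 ⟨h1, h2⟩)
      rcases h2 with h2 | h2 <;> simp [zero_pow h2]
    · rfl

end Macdonald

/-! ### Key polynomials -/

section Key

variable {n : ℕ}

/-- By induction on the row, all smaller values already occur higher in the same column, so the flag
bound is attained. -/
theorem isSSF_iff_of_antitone {α : Fin n → ℕ} (hα : Antitone α) {F : Filling α} :
    IsSSF α F ↔ ∀ i j, F i j = i := by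
  constructor
  · intro h i
    induction i using WellFoundedLT.induction with
    | ind i ih =>
      intro j
      refine le_antisymm (h.flag i j) (not_lt.1 fun hlt => ?_)
      have hj : (j : ℕ) < α (F i j) := lt_of_lt_of_le j.2 (hα hlt.le)
      exact h.column _ i j hj j.2 hlt.ne (ih _ hlt ⟨j, hj⟩)
  · intro h
    refine ⟨fun i j k _ => by rw [h, h], fun i j => (h i j).le, fun i k j _ _ hne => ?_,
      fun i k j _ _ hik hF => ?_⟩
    · rwa [h, h]
    · rw [h, h] at hF
      exact absurd hF hik.asymm

theorem ssfPoly_of_antitone {α : Fin n → ℕ} (hα : Antitone α) :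
    ssfPoly α = ∏ i, X i ^ α i := by
  classical
  rw [ssfPoly, Finset.sum_eq_single (fun i _ => i : Filling α)]
  · simp [weight]
  · intro F hF hne
    refine absurd ?_ hne
    funext i j
    exact (isSSF_iff_of_antitone hα).1 (Finset.mem_filter.1 hF).2 i j
  · intro h
    exact absurd (Finset.mem_filter.2 ⟨Finset.mem_univ _,
      (isSSF_iff_of_antitone hα).2 fun _ _ => rfl⟩) h

theorem IsKeyPoly.eq_ssfPoly {α : Fin n → ℕ} {f : MvPolynomial (Fin n) ℤ} (h : IsKeyPoly α f) :
    f = ssfPoly α := by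
  induction h with
  | partition α hα => exact (ssfPoly_of_antitone hα).symm
  | ascent α r hr hlt f _ ih => rw [ih, demazure_ssfPoly α r hr hlt]

theorem exists_ascent {α : Fin n → ℕ} (h : ¬ Antitone α) :
    ∃ (r : ℕ) (hr : r + 1 < n), α ⟨r, by omega⟩ < α ⟨r + 1, hr⟩ := by
  by_contra hc
  push Not at hc
  cases n with
  | zero => exact h fun i => i.elim0
  | succ n => exact h (Fin.antitone_iff_succ_le.2 fun i => hc i (by omega))

/-- The measure that makes the recursion for key polynomials terminate, whatever ascents are chosen.
-/
theorem sum_mul_swapParts_lt {α : Fin n → ℕ} {r : ℕ} {hr : r + 1 < n}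
    (h : α ⟨r, by omega⟩ < α ⟨r + 1, hr⟩) :
    ∑ i : Fin n, (i : ℕ) * swapParts r hr α i < ∑ i : Fin n, (i : ℕ) * α i := by
  set p : Fin n := ⟨r, by omega⟩ with hp
  set q : Fin n := ⟨r + 1, hr⟩ with hq
  have hqp : q ∈ Finset.univ.erase p := by simp [hp, hq]
  have key : ∀ f : Fin n → ℕ, ∑ i, f i = f p + (f q + ∑ i ∈ (Finset.univ.erase p).erase q, f i) :=
    fun f => by
      rw [Finset.add_sum_erase _ _ hqp, Finset.add_sum_erase _ _ (Finset.mem_univ p)]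
  rw [key, key fun i : Fin n => (i : ℕ) * α i]
  have e : ∀ i ∈ (Finset.univ.erase p).erase q, (i : ℕ) * swapParts r hr α i = i * α i := by
    intro i hi
    simp only [Finset.mem_erase] at hi
    rw [swapParts, Equiv.swap_apply_of_ne_of_ne hi.2.1 hi.1]
  rw [Finset.sum_congr rfl e]
  have e1 : swapParts r hr α p = α q := congrArg α (Equiv.swap_apply_left p q)
  have e2 : swapParts r hr α q = α p := congrArg α (Equiv.swap_apply_right p q)
  rw [e1, e2]
  have h1 : (p : ℕ) = r := rfl
  have h2 : (q : ℕ) = r + 1 := rfl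
  rw [h1, h2]
  nlinarith

theorem exists_isKeyPoly (α : Fin n → ℕ) : ∃ f, IsKeyPoly α f := by
  induction h : ∑ i : Fin n, (i : ℕ) * α i using Nat.strong_induction_on generalizing α with
  | _ N ih =>
    by_cases hα : Antitone α
    · exact ⟨_, IsKeyPoly.partition α hα⟩
    · obtain ⟨r, hr, hlt⟩ := exists_ascent hα
      obtain ⟨f, hf⟩ := ih _ (h ▸ sum_mul_swapParts_lt hlt) (swapParts r hr α) rfl
      exact ⟨_, IsKeyPoly.ascent α r hr hlt f hf⟩

theorem isKeyPoly_iff (α : Fin n → ℕ) (f : MvPolynomial (Fin n) ℤ) :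
    IsKeyPoly α f ↔ f = ssfPoly α := by
  refine ⟨IsKeyPoly.eq_ssfPoly, ?_⟩
  rintro rfl
  obtain ⟨f, hf⟩ := exists_isKeyPoly α
  rwa [← hf.eq_ssfPoly]

end Key

end Skyline

theorem mainTheorem1 {n : ℕ} (α : Fin n → ℕ) :
    (∀ (r : ℕ) (hr : r + 1 < n), Skyline.IsFirstAscent α r hr →
      Skyline.demazure r hr (Skyline.ssfPoly (Skyline.swapParts r hr α)) = Skyline.ssfPoly α) ∧
    (∀ f : MvPolynomial (Fin n) ℤ, Skyline.IsKeyPoly α f ↔ f = Skyline.ssfPoly α) ∧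
    (∀ f : MvPolynomial (Fin n) ℤ, Skyline.IsKeyPoly α f →
      Skyline.macdonaldE α (0 : ℚ) 0 = MvPolynomial.map (Int.castRingHom ℚ) f) := by
  refine ⟨fun r hr h => Skyline.demazure_ssfPoly α r hr h.2, Skyline.isKeyPoly_iff α,
    fun f hf => ?_⟩
  rw [hf.eq_ssfPoly, Skyline.macdonaldE_zero_zero]
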